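/- \textbf{Setting.} All manifolds are smooth, finite-dimensional and without boundary. Let $(\mathcal{E},\langle\cdot,\cdot\rangle_{\mathcal{E}})$ be a finite-dimensional real inner product space, let $\mathcal{M}\subset\mathcal{E}$ be a smoothly embedded (not necessarily isometrically embedded) manifold, and let $\mathsf{g}$ be a smooth function from $\mathcal{M}$ to the self-adjoint positive-definite operators on $\mathcal{E}$. Give $\mathcal{M}$ the Riemannian metric $\langle u,v\rangle_R=\langle u,\mathsf{g}(Y)v\rangle_{\mathcal{E}}$ for $u,v\in T_Y\mathcal{M}\subset\mathcal{E}$, and let $\nabla$ be its Levi-Civita connection. $\mathrm{D}_u$ denotes the derivative of a (scalar-, vector- or operator-valued) function on $\mathcal{M}$ in the direction $u$. For a family $\mathcal{H}$ of subspaces $\mathcal{H}_Y\subset T_Y\mathcal{M}$, $\Pi_{\mathcal{H},\mathsf{g}}(Y)$ is the projection of $\mathcal{E}$ onto $\mathcal{H}_Y$ for the inner product $\langle\cdot,\mathsf{g}(Y)\cdot\rangle_{\mathcal{E}}$. An \emph{ambient gradient} of $f:\mathcal{M}\to\mathbb{R}$ is a function $\hat f_Y:\mathcal{M}\to\mathcal{E}$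 with $\langle\eta,\hat f_Y\rangle_{\mathcal{E}}=\mathrm{D}_\eta f$ for all vector fields $\eta$ on $\mathcal{M}$. The \emph{$\mathcal{H}$-Riemannian gradient} $\mathsf{rgrad}_{\mathcal{H},f}$ is the $\mathcal{H}$-valued vector field with $\langle\mathsf{rgrad}_{\mathcal{H},f},v\rangle_R=\mathrm{D}_vf$ for all $v\in\mathcal{H}$, and the \emph{$\mathcal{H}$-Riemannian Hessians} are $\mathsf{rhess}^{11}_{\mathcal{H},f}u=\Pi_{\mathcal{H},\mathsf{g}}\nabla_u\mathsf{rgrad}_{\mathcal{H},f}$ and $\mathsf{rhess}^{02}_{\mathcal{H},f}(u,v)=\langle\mathsf{rhess}^{11}_{\mathcal{H},f}u,v\rangle_R$ for $u,v\in\mathcal{H}_Y$. \textbf{1.} (a) Let $(e_i)$ be an orthonormal basis of $\mathcal{E}$ and let $f:\mathcal{M}\to\mathbb{R}$ be the restriction of a function $\hat f$ on $\mathcal{E}$ that is differentiable at every point of $\mathcal{M}$. Then $\hat f_Y:=\sum_i(\mathrm{D}_{e_i}\hat f)\,e_i:\mathcal{M}\to\mathcal{E}$ is the restriction of the gradient of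 $\hat f$ to $\mathcal{M}$, and it is an ambient gradient of $f$. (b) Let $\mathcal{E}_{\mathsf{J}}$ be a finite-dimensional inner product space, $U\subset\mathcal{E}$ open and $C:U\to\mathcal{E}_{\mathsf{J}}$ of class $C^1$, and suppose that $\mathcal{M}=\{Y\in U: C(Y)=0\}$ and that the Jacobian $\mathsf{J}_C(Y):\mathcal{E}\to\mathcal{E}_{\mathsf{J}}$ has rank $\dim\mathcal{E}_{\mathsf{J}}$ at every $Y\in\mathcal{M}$. Then $\mathsf{J}=\mathsf{J}_C(Y)$ maps $\mathcal{E}$ onto $\mathcal{E}_{\mathsf{J}}$ with nullspace $T_Y\mathcal{M}$ for every $Y\in\mathcal{M}$. Consequently, with $\mathsf{J}^{\mathfrak t}$ its adjoint, $\mathsf{J}\mathsf{g}^{-1}\mathsf{J}^{\mathfrak{t}}$ is invertible and $\Pi_{T\mathcal{M},\mathsf{g}}\,a=a-\mathsf{g}^{-1}\mathsf{J}^{\mathfrak{t}}(\mathsf{J}\mathsf{g}^{-1}\mathsf{J}^{\mathfrak{t}})^{-1}\mathsf{J}a$ for all $a\in\mathcal{E}$, everything being evaluated at $Y$. \textbf{2.}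 Let $\mathcal{B}$ be a Riemannian manifold with Levi-Civita connection $\nabla^{\mathcal{B}}$, and let $\pi:\mathcal{M}\to\mathcal{B}$ be a Riemannian submersion: smooth, onto, with $d\pi$ onto at each point and preserving inner products on the horizontal spaces $\mathcal{H}_Y=(\ker d\pi_Y)^{\perp}\subset T_Y\mathcal{M}$. For a tangent vector $v$ of $\mathcal{B}$ at $\pi(Y)$ its horizontal lift $v_{\mathcal{H}}$ at $Y$ is the unique element of $\mathcal{H}_Y$ with $d\pi(v_{\mathcal{H}})=v$. (a) For smooth vector fields $\xi,\eta$ on $\mathcal{B}$ with horizontal lifts $\xi_{\mathcal{H}},\eta_{\mathcal{H}}$, $$(\nabla^{\mathcal{B}}_\xi\eta)_{\mathcal{H}}=\Pi_{\mathcal{H},\mathsf{g}}\nabla_{\xi_{\mathcal{H}}}\eta_{\mathcal{H}}.$$ Hence it equals $\mathrm{D}_{\xi_{\mathcal{H}}}\eta_{\mathcal{H}}+\Gamma_{\mathcal{H}}(\xi_{\mathcal{H}},\eta_{\mathcal{H}})$, where $\Gamma_{\mathcal{H}}(u,v)=-(\mathrm{D}_{u}\Pi_{\mathcal{H},\mathsf{g}})v+\Pi_{\mathcal{H},\mathsf{g}}\mathsf{g}^{-1}\mathrm{K}(u,v)$,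 $\mathrm{K}(u,v)=\frac12\big((\mathrm{D}_u\mathsf{g})v+(\mathrm{D}_v\mathsf{g})u-\mathcal{X}(u,v)\big)$, and $\mathcal{X}$ is any $\mathcal{E}$-valued bilinear form on tangent vectors with $\langle\mathcal{X}(u,v),w\rangle_{\mathcal{E}}=\langle u,(\mathrm{D}_w\mathsf{g})v\rangle_{\mathcal{E}}$ for all $w\in T_Y\mathcal{M}$ (such a form exists). (b) For every smooth $f:\mathcal{B}\to\mathbb{R}$, the Riemannian gradient $\mathsf{rgrad}_f$ and the Riemannian Hessians $\mathsf{rhess}^{11}_fv=\nabla^{\mathcal{B}}_v\mathsf{rgrad}_f$, $\mathsf{rhess}^{02}_f(v,w)=\langle\nabla^{\mathcal{B}}_v\mathsf{rgrad}_f,w\rangle$ on $\mathcal{B}$ lift to the $\mathcal{H}$-Riemannian gradient and Hessians of $f\circ\pi$ on $\mathcal{M}$: for $Y\in\mathcal{M}$ and $v,w\in T_{\pi(Y)}\mathcal{B}$, $$(\mathsf{rgrad}_f)_{\mathcal{H}}=\mathsf{rgrad}_{\mathcal{H},f\circ\pi},\qquad(\mathsf{rhess}^{11}_fv)_{\mathcal{H}}=\mathsf{rhess}^{11}_{\mathcal{H},f\circ\pi}v_{\mathcal{H}},\qquad\mathsf{rhess}^{02}_f(v,w)=\mathsf{rhess}^{02}_{\mathcal{H},f\circ\pi}(v_{\mathcal{H}},w_{\mathcal{H}})\quad\text{at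 }Y.$$ -/

import Mathlib

open Manifold Bundle
open scoped ContDiff RealInnerProductSpace

/-! ### Linear algebra: projections with respect to an operator inner product -/

section Projection

variable {E : Type*} [NormedAddCommGroup E] [InnerProductSpace ℝ E] [FiniteDimensional ℝ E]

/-- For a self-adjoint positive-definite operator `A` on `E`, the projection of `E` onto the
subspace `W` under the inner product `⟪a, A b⟫`. With `N` the inclusion of `W` it is
`N (Nᵗ A N)⁻¹ Nᵗ A`; its defining property is `metricProjection_mem` together with
`inner_metricProjection`, and it is the only map with it by `eq_metricProjection`. -/
noncomputable def metricProjection (A : E →L[ℝ] E) (W : Submodule ℝ E) : E →L[ℝ] E :=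
  W.subtypeL ∘L (W.subtypeL.adjoint ∘L A ∘L W.subtypeL).inverse ∘L W.subtypeL.adjoint ∘L A

lemma metricProjection_mem (A : E →L[ℝ] E) (W : Submodule ℝ E) (e : E) :
    metricProjection A W e ∈ W := by
  simp [metricProjection]

lemma inner_metricProjection (A : E →L[ℝ] E) (W : Submodule ℝ E)
    (hs : ∀ a b : E, ⟪A a, b⟫ = ⟪a, A b⟫) (hp : ∀ a : E, a ≠ 0 → 0 < ⟪a, A a⟫)
    (e w : E) (hw : w ∈ W) : ⟪metricProjection A W e, A w⟫ = ⟪e, A w⟫ := by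
  set N := W.subtypeL
  set T : W →L[ℝ] W := N.adjoint ∘L A ∘L N with hT
  have hinj : Function.Injective T := by
    refine (injective_iff_map_eq_zero T).2 fun a ha ↦ ?_
    by_contra hne
    have h1 : ⟪a, T a⟫ = ⟪(a : E), A a⟫ := by
      rw [hT]
      simp [ContinuousLinearMap.adjoint_inner_right, N]
    have h2 := hp (a : E) (by simpa using hne)
    rw [ha, inner_zero_right] at h1
    linarith
  have hinv : T.IsInvertible :=
    ⟨(LinearEquiv.ofInjectiveEndo T.toLinearMap hinj).toContinuousLinearEquiv, by ext; rfl⟩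
  have key : T (T.inverse (N.adjoint (A e))) = N.adjoint (A e) := by
    obtain ⟨S, hS⟩ := hinv
    rw [← hS]
    simp
  have h3 := congrArg (fun z : W ↦ ⟪z, (⟨w, hw⟩ : W)⟫) key
  simp only [hT, ContinuousLinearMap.comp_apply, ContinuousLinearMap.adjoint_inner_left, hs] at h3
  simpa [metricProjection, N, hT] using h3

lemma eq_metricProjection (A : E →L[ℝ] E) (W : Submodule ℝ E)
    (hs : ∀ a b : E, ⟪A a, b⟫ = ⟪a, A b⟫) (hp : ∀ a : E, a ≠ 0 → 0 < ⟪a, A a⟫)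
    (e p : E) (hpW : p ∈ W) (h : ∀ w ∈ W, ⟪p, A w⟫ = ⟪e, A w⟫) :
    p = metricProjection A W e := by
  by_contra hne
  have hd : p - metricProjection A W e ∈ W := W.sub_mem hpW (metricProjection_mem A W e)
  have h1 := hp _ (sub_ne_zero.2 hne)
  have h2 : ⟪p - metricProjection A W e, A (p - metricProjection A W e)⟫ = 0 := by
    rw [inner_sub_left, h _ hd, inner_metricProjection A W hs hp e _ hd, sub_self]
  linarith

end Projection

/-! ### Riemannian manifolds -/

instance tangentSpace_finiteDimensional {V : Type*} [NormedAddCommGroup V] [NormedSpace ℝ V]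
    [FiniteDimensional ℝ V] {M : Type*} [TopologicalSpace M] [ChartedSpace V M] (x : M) :
    FiniteDimensional ℝ (TangentSpace 𝓘(ℝ, V) x) :=
  inferInstanceAs (FiniteDimensional ℝ V)

/-- A vector field `σ` on `M` is smooth. -/
def IsSmoothVectorField {V : Type*} [NormedAddCommGroup V] [NormedSpace ℝ V]
    {M : Type*} [TopologicalSpace M] [ChartedSpace V M] [IsManifold 𝓘(ℝ, V) ∞ M]
    (σ : ∀ x : M, TangentSpace 𝓘(ℝ, V) x) : Prop :=
  ContMDiff 𝓘(ℝ, V) (𝓘(ℝ, V).prod 𝓘(ℝ, V)) ∞ (fun x ↦ TotalSpace.mk' V x (σ x))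

section Riemannian

variable {V : Type*} [NormedAddCommGroup V] [NormedSpace ℝ V] [FiniteDimensional ℝ V]
  {M : Type*} [TopologicalSpace M] [ChartedSpace V M]
  [RiemannianBundle (fun x : M ↦ TangentSpace 𝓘(ℝ, V) x)]

instance tangentSpace_completeSpace (x : M) : CompleteSpace (TangentSpace 𝓘(ℝ, V) x) :=
  FiniteDimensional.complete ℝ _

/-- `∇` is the Levi-Civita connection: it is compatible with the metric,
`D_u ⟪σ, τ⟫ = ⟪∇_u σ, τ⟫ + ⟪σ, ∇_u τ⟫`, and torsion-free. -/
structure IsLeviCivita [IsManifold 𝓘(ℝ, V) ∞ M]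
    (nabla : CovariantDerivative 𝓘(ℝ, V) V (TangentSpace 𝓘(ℝ, V) : M → Type _)) : Prop where
  metric : ∀ (σ τ : ∀ x : M, TangentSpace 𝓘(ℝ, V) x) (x : M),
    MDifferentiableAt 𝓘(ℝ, V) (𝓘(ℝ, V).prod 𝓘(ℝ, V)) (fun y ↦ TotalSpace.mk' V y (σ y)) x →
    MDifferentiableAt 𝓘(ℝ, V) (𝓘(ℝ, V).prod 𝓘(ℝ, V)) (fun y ↦ TotalSpace.mk' V y (τ y)) x →
    ∀ u : TangentSpace 𝓘(ℝ, V) x,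
      mvfderiv 𝓘(ℝ, V) (fun y ↦ ⟪σ y, τ y⟫) x u = ⟪nabla σ x u, τ x⟫ + ⟪σ x, nabla τ x u⟫
  torsion : nabla.torsion = 0

/-- The Riemannian gradient: `⟪rgrad f, v⟫ = D_v f` for all tangent vectors `v`. -/
noncomputable def riemannianGradient (f : M → ℝ) (x : M) : TangentSpace 𝓘(ℝ, V) x :=
  (InnerProductSpace.toDual ℝ (TangentSpace 𝓘(ℝ, V) x)).symm (mvfderiv 𝓘(ℝ, V) f x)

/-- The `H`-Riemannian gradient for a family `H` of subspaces of the tangent spaces: the element of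
`H` with `⟪rgrad_H f, v⟫ = D_v f` for all `v` in `H`. -/
noncomputable def subbundleGradient (H : ∀ x : M, Submodule ℝ (TangentSpace 𝓘(ℝ, V) x))
    (f : M → ℝ) (x : M) : TangentSpace 𝓘(ℝ, V) x :=
  ((InnerProductSpace.toDual ℝ (H x)).symm
    ((mvfderiv 𝓘(ℝ, V) f x).comp (H x).subtypeL) : H x)

/-- The Riemannian Hessian operator `v ↦ ∇_v rgrad f`. -/
noncomputable def riemannianHessian [IsManifold 𝓘(ℝ, V) ∞ M]
    (nabla : CovariantDerivative 𝓘(ℝ, V) V (TangentSpace 𝓘(ℝ, V) : M → Type _))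
    (f : M → ℝ) (x : M) (v : TangentSpace 𝓘(ℝ, V) x) : TangentSpace 𝓘(ℝ, V) x :=
  nabla (riemannianGradient f) x v

/-- The Riemannian Hessian bilinear form `(v, w) ↦ ⟪∇_v rgrad f, w⟫`. -/
noncomputable def riemannianHessianForm [IsManifold 𝓘(ℝ, V) ∞ M]
    (nabla : CovariantDerivative 𝓘(ℝ, V) V (TangentSpace 𝓘(ℝ, V) : M → Type _))
    (f : M → ℝ) (x : M) (v w : TangentSpace 𝓘(ℝ, V) x) : ℝ :=
  ⟪riemannianHessian nabla f x v, w⟫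

end Riemannian

/-! ### Riemannian submersions -/

section Submersion

variable {V : Type*} [NormedAddCommGroup V] [NormedSpace ℝ V] [FiniteDimensional ℝ V]
  {M : Type*} [TopologicalSpace M] [ChartedSpace V M]
  [RiemannianBundle (fun x : M ↦ TangentSpace 𝓘(ℝ, V) x)]
  {V' : Type*} [NormedAddCommGroup V'] [NormedSpace ℝ V']
  {B : Type*} [TopologicalSpace B] [ChartedSpace V' B]

/-- The horizontal space: the orthogonal complement of the vertical space `ker dp`. -/
noncomputable def horizontalSpace (p : M → B) (x : M) : Submodule ℝ (TangentSpace 𝓘(ℝ, V) x) :=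
  (LinearMap.ker (mfderiv 𝓘(ℝ, V) 𝓘(ℝ, V') p x).toLinearMap)ᗮ

/-- The horizontal lift to `x` of a tangent vector `v` of `B` at `p x`: the horizontal vector that
`dp` sends to `v` (see `horizontalLift_spec` and `horizontalLift_unique`). -/
noncomputable def horizontalLift (p : M → B) (x : M) (v : TangentSpace 𝓘(ℝ, V') (p x)) :
    TangentSpace 𝓘(ℝ, V) x :=
  Classical.epsilon fun u ↦
    u ∈ horizontalSpace (V := V) (V' := V') p x ∧ mfderiv 𝓘(ℝ, V) 𝓘(ℝ, V') p x u = v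

lemma horizontalLift_spec (p : M → B) (x : M)
    (hp : Function.Surjective (mfderiv 𝓘(ℝ, V) 𝓘(ℝ, V') p x))
    (v : TangentSpace 𝓘(ℝ, V') (p x)) :
    horizontalLift (V := V) p x v ∈ horizontalSpace (V := V) (V' := V') p x ∧
      mfderiv 𝓘(ℝ, V) 𝓘(ℝ, V') p x (horizontalLift (V := V) p x v) = v := by
  apply Classical.epsilon_spec
    (p := fun u ↦ u ∈ horizontalSpace (V := V) (V' := V') p x ∧
      mfderiv 𝓘(ℝ, V) 𝓘(ℝ, V') p x u = v)
  obtain ⟨u, hu⟩ := hp v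
  obtain ⟨a, ha, b, hb, hab⟩ := Submodule.exists_add_mem_mem_orthogonal
    (K := LinearMap.ker (mfderiv 𝓘(ℝ, V) 𝓘(ℝ, V') p x).toLinearMap) u
  refine ⟨b, hb, ?_⟩
  have ha' : mfderiv 𝓘(ℝ, V) 𝓘(ℝ, V') p x a = 0 := ha
  rw [← hu, hab, map_add, ha', zero_add]

lemma horizontalLift_unique (p : M → B) (x : M) (u₁ u₂ : TangentSpace 𝓘(ℝ, V) x)
    (h₁ : u₁ ∈ horizontalSpace (V := V) (V' := V') p x)
    (h₂ : u₂ ∈ horizontalSpace (V := V) (V' := V') p x)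
    (h : mfderiv 𝓘(ℝ, V) 𝓘(ℝ, V') p x u₁ = mfderiv 𝓘(ℝ, V) 𝓘(ℝ, V') p x u₂) : u₁ = u₂ := by
  have hk : u₁ - u₂ ∈ LinearMap.ker (mfderiv 𝓘(ℝ, V) 𝓘(ℝ, V') p x).toLinearMap := by
    change mfderiv 𝓘(ℝ, V) 𝓘(ℝ, V') p x (u₁ - u₂) = 0
    rw [map_sub, h, sub_self]
  have hz := (Submodule.sub_mem _ h₁ h₂ :
    u₁ - u₂ ∈ horizontalSpace (V := V) (V' := V') p x) (u₁ - u₂) hk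
  exact sub_eq_zero.1 (inner_self_eq_zero.1 hz)

/-- The horizontal lift of a vector field `ζ` on `B`. -/
noncomputable def horizontalLiftField (p : M → B) (ζ : ∀ b : B, TangentSpace 𝓘(ℝ, V') b) (x : M) :
    TangentSpace 𝓘(ℝ, V) x :=
  horizontalLift p x (ζ (p x))

/-- A Riemannian submersion: a smooth surjective submersion whose differential preserves inner
products of vectors normal to the fibres. -/
structure IsRiemannianSubmersion [FiniteDimensional ℝ V']
    [RiemannianBundle (fun b : B ↦ TangentSpace 𝓘(ℝ, V') b)] (p : M → B) : Prop where
  contMDiff : ContMDiff 𝓘(ℝ, V) 𝓘(ℝ, V') ∞ p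
  surjective : Function.Surjective p
  surjective_mfderiv : ∀ x : M, Function.Surjective (mfderiv 𝓘(ℝ, V) 𝓘(ℝ, V') p x)
  inner_mfderiv : ∀ x : M, ∀ u ∈ horizontalSpace (V := V) (V' := V') p x,
    ∀ v ∈ horizontalSpace (V := V) (V' := V') p x,
      ⟪mfderiv 𝓘(ℝ, V) 𝓘(ℝ, V') p x u, mfderiv 𝓘(ℝ, V) 𝓘(ℝ, V') p x v⟫ = ⟪u, v⟫

end Submersion

/-! ### Embedded ambient structures -/

section Ambient

variable {E : Type*} [NormedAddCommGroup E] [InnerProductSpace ℝ E] [FiniteDimensional ℝ E]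
  {V : Type*} [NormedAddCommGroup V] [NormedSpace ℝ V]
  {M : Type*} [TopologicalSpace M] [ChartedSpace V M]

/-- `M` is smoothly embedded in the inner product space `E` by `ι`, `g` is a smooth function on `M`
whose values are self-adjoint positive-definite operators on `E`, and the Riemannian metric of `M`
is the one induced by `g`. The embedding need not be isometric. -/
structure IsEmbeddedAmbientStructure [RiemannianBundle (fun x : M ↦ TangentSpace 𝓘(ℝ, V) x)]
    (ι : M → E) (g : M → E →L[ℝ] E) : Prop where
  isSmoothEmbedding : IsSmoothEmbedding 𝓘(ℝ, V) 𝓘(ℝ, E) ∞ ι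
  contMDiff_metric : ContMDiff 𝓘(ℝ, V) 𝓘(ℝ, E →L[ℝ] E) ∞ g
  metric_symm : ∀ Y : M, ∀ a b : E, ⟪g Y a, b⟫ = ⟪a, g Y b⟫
  metric_pos : ∀ Y : M, ∀ a : E, a ≠ 0 → 0 < ⟪a, g Y a⟫
  inner_eq : ∀ Y : M, ∀ u v : TangentSpace 𝓘(ℝ, V) Y,
    ⟪u, v⟫ = ⟪mvfderiv 𝓘(ℝ, V) ι Y u, g Y (mvfderiv 𝓘(ℝ, V) ι Y v)⟫

/-- `F : M → E` is an ambient gradient of `f`: for all vector fields `η` on `M` one has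
`⟪η, F⟫_E = D_η f`, where `η(Y)` is regarded as an element of `E`. -/
def IsAmbientGradient (ι : M → E) (f : M → ℝ) (F : M → E) : Prop :=
  ∀ η : ∀ Y : M, TangentSpace 𝓘(ℝ, V) Y, ∀ Y : M,
    ⟪mvfderiv 𝓘(ℝ, V) ι Y (η Y), F Y⟫ = mvfderiv 𝓘(ℝ, V) f Y (η Y)

/-- The subspace `H_Y` of `T_Y M`, regarded as a subspace of `E`. -/
noncomputable def ambientFiber (ι : M → E) (H : ∀ Y : M, Submodule ℝ (TangentSpace 𝓘(ℝ, V) Y))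
    (Y : M) : Submodule ℝ E :=
  (H Y).map (mvfderiv 𝓘(ℝ, V) ι Y).toLinearMap

/-- The projection `Π_{H,g}`: at `Y` it is the projection of `E` to `H_Y` associated with `g Y`. -/
noncomputable def bundleProjection (ι : M → E) (g : M → E →L[ℝ] E)
    (H : ∀ Y : M, Submodule ℝ (TangentSpace 𝓘(ℝ, V) Y)) (Y : M) : E →L[ℝ] E :=
  metricProjection (g Y) (ambientFiber ι H Y)

/-- `J(Y) : E → F` is onto, with nullspace the fibre `H_Y`, for all `Y` in `M`. -/
def IsDefiningOperator {F : Type*} [NormedAddCommGroup F] [InnerProductSpace ℝ F]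
    (ι : M → E) (H : ∀ Y : M, Submodule ℝ (TangentSpace 𝓘(ℝ, V) Y)) (J : M → E →L[ℝ] F) : Prop :=
  ∀ Y : M, LinearMap.range (J Y).toLinearMap = ⊤ ∧
    LinearMap.ker (J Y).toLinearMap = ambientFiber ι H Y

/-- `X` is an index-raising term: an `E`-valued bilinear form on tangent vectors with
`⟪X(u, v), w⟫_E = ⟪u, (D_w g) v⟫_E` for all tangent vectors `w`. -/
def IsIndexRaisingTerm (ι : M → E) (g : M → E →L[ℝ] E)
    (X : ∀ Y : M, TangentSpace 𝓘(ℝ, V) Y →ₗ[ℝ] TangentSpace 𝓘(ℝ, V) Y →ₗ[ℝ] E) : Prop :=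
  ∀ (Y : M) (u v w : TangentSpace 𝓘(ℝ, V) Y),
    ⟪X Y u v, mvfderiv 𝓘(ℝ, V) ι Y w⟫ =
      ⟪mvfderiv 𝓘(ℝ, V) ι Y u, mvfderiv 𝓘(ℝ, V) g Y w (mvfderiv 𝓘(ℝ, V) ι Y v)⟫

/-- The Christoffel metric term `K(u, v) = ((D_u g) v + (D_v g) u - X(u, v)) / 2`. -/
noncomputable def christoffelMetricTerm (ι : M → E) (g : M → E →L[ℝ] E)
    (X : ∀ Y : M, TangentSpace 𝓘(ℝ, V) Y →ₗ[ℝ] TangentSpace 𝓘(ℝ, V) Y →ₗ[ℝ] E)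
    (Y : M) (u v : TangentSpace 𝓘(ℝ, V) Y) : E :=
  (1 / 2 : ℝ) • (mvfderiv 𝓘(ℝ, V) g Y u (mvfderiv 𝓘(ℝ, V) ι Y v) +
    mvfderiv 𝓘(ℝ, V) g Y v (mvfderiv 𝓘(ℝ, V) ι Y u) - X Y u v)

/-- The Christoffel function `Γ_H(u, v) = -(D_u Π_{H,g}) v + Π_{H,g} g⁻¹ K(u, v)`. -/
noncomputable def christoffelFunction (ι : M → E) (g : M → E →L[ℝ] E)
    (X : ∀ Y : M, TangentSpace 𝓘(ℝ, V) Y →ₗ[ℝ] TangentSpace 𝓘(ℝ, V) Y →ₗ[ℝ] E)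
    (H : ∀ Y : M, Submodule ℝ (TangentSpace 𝓘(ℝ, V) Y))
    (Y : M) (u v : TangentSpace 𝓘(ℝ, V) Y) : E :=
  -(mvfderiv 𝓘(ℝ, V) (bundleProjection ι g H) Y u (mvfderiv 𝓘(ℝ, V) ι Y v)) +
    bundleProjection ι g H Y ((g Y).inverse (christoffelMetricTerm ι g X Y u v))

variable [FiniteDimensional ℝ V] [RiemannianBundle (fun x : M ↦ TangentSpace 𝓘(ℝ, V) x)]

/-- The `H`-Riemannian Hessian operator `u ↦ Π_{H,g} ∇_u rgrad_H f`, with values in `H_Y ⊆ E`. -/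
noncomputable def subbundleHessian [IsManifold 𝓘(ℝ, V) ∞ M] (ι : M → E) (g : M → E →L[ℝ] E)
    (nabla : CovariantDerivative 𝓘(ℝ, V) V (TangentSpace 𝓘(ℝ, V) : M → Type _))
    (H : ∀ Y : M, Submodule ℝ (TangentSpace 𝓘(ℝ, V) Y)) (f : M → ℝ)
    (Y : M) (u : TangentSpace 𝓘(ℝ, V) Y) : E :=
  bundleProjection ι g H Y (mvfderiv 𝓘(ℝ, V) ι Y (nabla (subbundleGradient H f) Y u))

/-- The `H`-Riemannian Hessian bilinear form `(u, v) ↦ ⟪Π_{H,g} ∇_u rgrad_H f, v⟫`, where the inner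
product is the one given by `g`. -/
noncomputable def subbundleHessianForm [IsManifold 𝓘(ℝ, V) ∞ M] (ι : M → E) (g : M → E →L[ℝ] E)
    (nabla : CovariantDerivative 𝓘(ℝ, V) V (TangentSpace 𝓘(ℝ, V) : M → Type _))
    (H : ∀ Y : M, Submodule ℝ (TangentSpace 𝓘(ℝ, V) Y)) (f : M → ℝ)
    (Y : M) (u v : TangentSpace 𝓘(ℝ, V) Y) : ℝ :=
  ⟪subbundleHessian ι g nabla H f Y u, g Y (mvfderiv 𝓘(ℝ, V) ι Y v)⟫

end Ambient

/-!
Write `ι` for the embedding, `H` for the horizontal bundle and `Π` for the projection to `H` in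
the inner product given by `g`. Everything about the submersion comes from one adjointness
(`inner_horizontalLift`): `⟪u, v_H⟫ = ⟪dp u, v⟫`. Hence inner products of lifts are those of the
given vectors, and the lift of a gradient is the horizontal gradient of the pulled-back function.

The connections are known through the Koszul formula (`IsLeviCivita.koszul`). Lifted fields are
`p`-related to the given ones, so that their brackets are (`mfderiv_mlieBracket_of_related`), and
each term of the formula for lifts on `M` equals the corresponding term on `B`. This gives
`⟪∇ᴹ_{v_H} η_H, w_H⟫ = ⟪∇ᴮ_v η, w⟫` (`inner_nabla_horizontalLift`), which is the assertion that
`Π ∇ᴹ` lifts `∇ᴮ`; applied to the gradient field it gives the Hessians.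

Brackets are computed with vector-valued functions: `D_[X,Y] F = D_X (D_Y F) - D_Y (D_X F)`
(`mvfderiv_mlieBracket`), with a chart of `B` for `F` in the statement on related fields, and with
`ι` in the Koszul formula on `M` when the metric is expressed by `g`. In the latter case the
formula says that `ι_* ∇_u η` and `D_u η + g⁻¹ K(u, η)` have the same projection to each subbundle
(`inner_mvfderiv_nabla`). Together with the derivative of `Π η = η` for horizontal `η` this is the
formula with the Christoffel function (`bundleProjection_nabla_eq`).

The differentiability that these computations need is not part of the definitions of lifts,
gradients and projections. It follows from the inversion of Gram operators: a field is
differentiable if its inner products with differentiable fields are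
(`mdifferentiableAt_vectorField_of_inner`), and `Π = N G⁻¹ Nᵗ g` for a differentiable local
parametrization `N` of `H` (`mdifferentiableAt_metricProjection`).

For a constraint `C`, each vector of `ker J` is the velocity of a curve in the zero set, by the
implicit function theorem, and a curve that runs in an embedded manifold has tangent velocity
(`mem_range_mvfderiv_of_hasDerivAt`). The formula for the projection to `ker J` is checked on its
defining property (`metricProjection_ker`).
-/

open VectorField Topology

/-! ### Calculus of vector-valued functions on a manifold -/

section

variable {V : Type*} [NormedAddCommGroup V] [NormedSpace ℝ V]
  {M : Type*} [TopologicalSpace M] [ChartedSpace V M]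
  {W W₁ W₂ : Type*} [NormedAddCommGroup W] [NormedSpace ℝ W]
  [NormedAddCommGroup W₁] [NormedSpace ℝ W₁] [NormedAddCommGroup W₂] [NormedSpace ℝ W₂]

lemma MDifferentiableAt.differentiableAt_comp_extChartAt_symm {f : M → W} {x : M}
    (hf : MDifferentiableAt 𝓘(ℝ, V) 𝓘(ℝ, W) f x) :
    DifferentiableAt ℝ (f ∘ (extChartAt 𝓘(ℝ, V) x).symm) (extChartAt 𝓘(ℝ, V) x x) := by
  have := hf.2
  simp only [DifferentiableWithinAtProp, mfld_simps, differentiableWithinAt_univ] at this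
  exact this

lemma MDifferentiableAt.mvfderiv_eq_fderiv {f : M → W} {x : M}
    (hf : MDifferentiableAt 𝓘(ℝ, V) 𝓘(ℝ, W) f x) (v : TangentSpace 𝓘(ℝ, V) x) :
    mvfderiv 𝓘(ℝ, V) f x v =
      fderiv ℝ (f ∘ (extChartAt 𝓘(ℝ, V) x).symm) (extChartAt 𝓘(ℝ, V) x x) v := by
  rw [hf.mvfderiv]
  simp only [mfld_simps, fderivWithin_univ]
  rfl

lemma MDifferentiableAt.bilin (L : W₁ →L[ℝ] W₂ →L[ℝ] W) {a : M → W₁} {b : M → W₂} {x : M}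
    (ha : MDifferentiableAt 𝓘(ℝ, V) 𝓘(ℝ, W₁) a x) (hb : MDifferentiableAt 𝓘(ℝ, V) 𝓘(ℝ, W₂) b x) :
    MDifferentiableAt 𝓘(ℝ, V) 𝓘(ℝ, W) (fun y ↦ L (a y) (b y)) x :=
  (L.isBoundedBilinearMap.differentiableAt (a x, b x)).mdifferentiableAt.comp x
    (ha.prodMk_space hb)

lemma MDifferentiableAt.mvfderiv_bilin (L : W₁ →L[ℝ] W₂ →L[ℝ] W) {a : M → W₁} {b : M → W₂} {x : M}
    (ha : MDifferentiableAt 𝓘(ℝ, V) 𝓘(ℝ, W₁) a x) (hb : MDifferentiableAt 𝓘(ℝ, V) 𝓘(ℝ, W₂) b x)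
    (v : TangentSpace 𝓘(ℝ, V) x) :
    mvfderiv 𝓘(ℝ, V) (fun y ↦ L (a y) (b y)) x v =
      L (mvfderiv 𝓘(ℝ, V) a x v) (b x) + L (a x) (mvfderiv 𝓘(ℝ, V) b x v) := by
  rw [(ha.bilin L hb).mvfderiv_eq_fderiv, ha.mvfderiv_eq_fderiv, hb.mvfderiv_eq_fderiv]
  have h := L.hasFDerivAt_of_bilinear ha.differentiableAt_comp_extChartAt_symm.hasFDerivAt
    hb.differentiableAt_comp_extChartAt_symm.hasFDerivAt
  have h2 : ∀ w : V, _ = _ := fun w ↦ congrArg (fun T : V →L[ℝ] W ↦ T w) h.fderiv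
  simp only [add_apply, ContinuousLinearMap.precompR_apply, ContinuousLinearMap.precompL_apply,
    Function.comp_apply, extChartAt_to_inv] at h2
  exact (h2 v).trans (add_comm _ _)

/-- In finite dimensions a family of operators is differentiable if it is so pointwise. -/
lemma mdifferentiableAt_clm_of_apply [FiniteDimensional ℝ W₁] {A : M → W₁ →L[ℝ] W₂} {x : M}
    (h : ∀ w, MDifferentiableAt 𝓘(ℝ, V) 𝓘(ℝ, W₂) (fun y ↦ A y w) x) :
    MDifferentiableAt 𝓘(ℝ, V) 𝓘(ℝ, W₁ →L[ℝ] W₂) A x := by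
  let b := Module.finBasis ℝ W₁
  have key : A = fun y ↦ ∑ i, ContinuousLinearMap.smulRightL ℝ W₁ W₂
      (b.coord i).toContinuousLinearMap (A y (b i)) := by
    funext y
    ext w
    conv_lhs => rw [← b.sum_repr w]
    simp only [map_sum, map_smul]
    simp
  have hs : A = ∑ i, fun y ↦ ContinuousLinearMap.smulRightL ℝ W₁ W₂
      (b.coord i).toContinuousLinearMap (A y (b i)) :=
    key.trans (Finset.sum_fn Finset.univ fun i y ↦ ContinuousLinearMap.smulRightL ℝ W₁ W₂
      (b.coord i).toContinuousLinearMap (A y (b i))).symm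
  rw [hs]
  exact MDifferentiableAt.sum fun i _ ↦ ((ContinuousLinearMap.smulRightL ℝ W₁ W₂
    (b.coord i).toContinuousLinearMap).differentiableAt.mdifferentiableAt).comp x (h (b i))

lemma MDifferentiableAt.clm_inverse [CompleteSpace W₁] {A : M → W₁ →L[ℝ] W₂} {x : M}
    (h : MDifferentiableAt 𝓘(ℝ, V) 𝓘(ℝ, W₁ →L[ℝ] W₂) A x) (hx : (A x).IsInvertible) :
    MDifferentiableAt 𝓘(ℝ, V) 𝓘(ℝ, W₂ →L[ℝ] W₁) (fun y ↦ (A y).inverse) x :=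
  (hx.contDiffAt_map_inverse (n := 1) |>.differentiableAt (by simp)).mdifferentiableAt.comp x h

lemma MDifferentiableAt.clm_apply_apply {A : M → W₁ →L[ℝ] W₂} {b : M → W₁} {x : M}
    (hA : MDiffAt A x) (hb : MDiffAt b x) : MDiffAt (fun y ↦ A y (b y)) x :=
  hA.bilin (ContinuousLinearMap.id ℝ (W₁ →L[ℝ] W₂)) hb

lemma MDifferentiableAt.mvfderiv_clm_apply_apply {A : M → W₁ →L[ℝ] W₂} {b : M → W₁} {x : M}
    (hA : MDiffAt A x) (hb : MDiffAt b x) (v : TangentSpace 𝓘(ℝ, V) x) :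
    mvfderiv 𝓘(ℝ, V) (fun y ↦ A y (b y)) x v =
      mvfderiv 𝓘(ℝ, V) A x v (b x) + A x (mvfderiv 𝓘(ℝ, V) b x v) := by
  simpa only [ContinuousLinearMap.id_apply] using
    hA.mvfderiv_bilin (ContinuousLinearMap.id ℝ (W₁ →L[ℝ] W₂)) hb v

variable {E : Type*} [NormedAddCommGroup E] [InnerProductSpace ℝ E]

lemma MDifferentiableAt.inner_apply {a b : M → E} {x : M} (ha : MDiffAt a x) (hb : MDiffAt b x) :
    MDiffAt (fun y ↦ ⟪a y, b y⟫) x :=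
  ha.bilin (innerSL ℝ) hb

lemma MDifferentiableAt.mvfderiv_inner_apply {a b : M → E} {x : M} (ha : MDiffAt a x)
    (hb : MDiffAt b x) (v : TangentSpace 𝓘(ℝ, V) x) :
    mvfderiv 𝓘(ℝ, V) (fun y ↦ ⟪a y, b y⟫) x v =
      ⟪mvfderiv 𝓘(ℝ, V) a x v, b x⟫ + ⟪a x, mvfderiv 𝓘(ℝ, V) b x v⟫ :=
  ha.mvfderiv_bilin (innerSL ℝ) hb v

variable {V' : Type*} [NormedAddCommGroup V'] [NormedSpace ℝ V']
  {B : Type*} [TopologicalSpace B] [ChartedSpace V' B]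

lemma mvfderiv_comp_manifold_apply {f : B → W} {p : M → B} {x : M} (hf : MDiffAt f (p x))
    (hp : MDiffAt p x) (u : TangentSpace 𝓘(ℝ, V) x) :
    mvfderiv 𝓘(ℝ, V) (f ∘ p) x u = mvfderiv 𝓘(ℝ, V') f (p x) (mfderiv 𝓘(ℝ, V) 𝓘(ℝ, V') p x u) :=
  mfderiv_comp_apply x hf hp u

lemma Filter.EventuallyEq.mvfderiv_eq {f f' : M → W} {x : M} (h : f =ᶠ[𝓝 x] f') :
    mvfderiv 𝓘(ℝ, V) f x = mvfderiv 𝓘(ℝ, V) f' x := by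
  have := h.mfderiv_eq (I := 𝓘(ℝ, V)) (I' := 𝓘(ℝ, W))
  ext u
  exact congrArg (fun T : V →L[ℝ] W ↦ T u) this

end

/-! ### Vector fields in charts and the Lie bracket -/

section

variable {V : Type*} [NormedAddCommGroup V] [NormedSpace ℝ V]
  {M : Type*} [TopologicalSpace M] [ChartedSpace V M]
  [IsManifold 𝓘(ℝ, V) ∞ M]
  {W : Type*} [NormedAddCommGroup W] [NormedSpace ℝ W]

/-- The expression of a vector field in the preferred chart at `x`, as a map of the model space: the
pullback under the inverse of that chart. -/
noncomputable def vectorFieldInChart (X : ∀ y : M, TangentSpace 𝓘(ℝ, V) y) (x : M) : V → V :=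
  mpullbackWithin 𝓘(ℝ, V) 𝓘(ℝ, V) (extChartAt 𝓘(ℝ, V) x).symm X (Set.range 𝓘(ℝ, V))

/-- At the base point no transformation is needed, since the tangent space at `x` is the model space
in the preferred chart at `x`. -/
lemma vectorFieldInChart_self (X : ∀ y : M, TangentSpace 𝓘(ℝ, V) y) (x : M) :
    vectorFieldInChart X x (extChartAt 𝓘(ℝ, V) x x) = X x := by
  have h := mfderivWithin_extChartAt_symm_inverse_apply (I := 𝓘(ℝ, V)) (x := x)
    (X ((extChartAt 𝓘(ℝ, V) x).symm (extChartAt 𝓘(ℝ, V) x x)))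
  refine h.trans ?_
  rw [extChartAt_to_inv]

lemma differentiableAt_vectorFieldInChart [CompleteSpace V]
    {X : ∀ y : M, TangentSpace 𝓘(ℝ, V) y} {x : M} (hX : MDiffAt (T% X) x) :
    DifferentiableAt ℝ (vectorFieldInChart X x) (extChartAt 𝓘(ℝ, V) x x) := by
  have := MDifferentiableWithinAt.differentiableWithinAt_mpullbackWithin_vectorField
    (mdifferentiableWithinAt_univ.2 hX)
  rw [Set.preimage_univ, Set.univ_inter] at this
  simp only [modelWithCornersSelf_coe, Set.range_id] at this
  simp only [vectorFieldInChart, modelWithCornersSelf_coe, Set.range_id]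
  exact differentiableWithinAt_univ.1 this

lemma mlieBracket_eq_lieBracket_vectorFieldInChart (X Y : ∀ y : M, TangentSpace 𝓘(ℝ, V) y) (x : M) :
    mlieBracket 𝓘(ℝ, V) X Y x = lieBracket ℝ (vectorFieldInChart X x) (vectorFieldInChart Y x)
      (extChartAt 𝓘(ℝ, V) x x) := by
  have h : (mfderiv 𝓘(ℝ, V) 𝓘(ℝ, V) (extChartAt 𝓘(ℝ, V) x) x).inverse =
      ContinuousLinearMap.id ℝ V := by
    rw [mfderiv_extChartAt_self]
    exact ContinuousLinearMap.inverse_id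
  rw [← mlieBracketWithin_univ, mlieBracketWithin_apply, h, Set.preimage_univ, Set.univ_inter]
  simp only [vectorFieldInChart, modelWithCornersSelf_coe, Set.range_id]
  exact congrFun (lieBracketWithin_univ (𝕜 := ℝ) (E := V)) _

omit [IsManifold 𝓘(ℝ, V) ∞ M] in
lemma ContMDiffAt.contDiffAt_comp_extChartAt_symm {n : ℕ∞ω} {F : M → W} {x : M}
    (hF : ContMDiffAt 𝓘(ℝ, V) 𝓘(ℝ, W) n F x) :
    ContDiffAt ℝ n (F ∘ (extChartAt 𝓘(ℝ, V) x).symm) (extChartAt 𝓘(ℝ, V) x x) := by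
  have := hF.2
  simp only [ContDiffWithinAtProp, mfld_simps, contDiffWithinAt_univ] at this
  exact this

/-- In the chart at `x`, the derivative of `F` along a vector field is the derivative of the
expression of `F` along the expression of the field. -/
lemma eventually_mvfderiv_vectorField_eq {F : M → W} {x : M}
    (hF : ContMDiffAt 𝓘(ℝ, V) 𝓘(ℝ, W) 2 F x) (X : ∀ y : M, TangentSpace 𝓘(ℝ, V) y) :
    (fun z ↦ mvfderiv 𝓘(ℝ, V) F ((extChartAt 𝓘(ℝ, V) x).symm z) (X ((extChartAt 𝓘(ℝ, V) x).symm z)))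
      =ᶠ[𝓝 (extChartAt 𝓘(ℝ, V) x x)]
    fun z ↦ fderiv ℝ (F ∘ (extChartAt 𝓘(ℝ, V) x).symm) z (vectorFieldInChart X x z) := by
  have hc : ContinuousAt (extChartAt 𝓘(ℝ, V) x).symm (extChartAt 𝓘(ℝ, V) x x) :=
    continuousAt_extChartAt_symm x
  have h1 : ∀ᶠ y in 𝓝 x, ContMDiffAt 𝓘(ℝ, V) 𝓘(ℝ, W) 2 F y :=
    (contMDiffAt_iff_contMDiffAt_nhds (by simp)).1 hF
  have h2 : ∀ᶠ z in 𝓝 (extChartAt 𝓘(ℝ, V) x x),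
      ContMDiffAt 𝓘(ℝ, V) 𝓘(ℝ, W) 2 F ((extChartAt 𝓘(ℝ, V) x).symm z) := by
    refine hc.eventually ?_
    rwa [extChartAt_to_inv]
  filter_upwards [h2, extChartAt_target_mem_nhds (I := 𝓘(ℝ, V)) x] with z hz hzt
  have hs := mdifferentiableWithinAt_extChartAt_symm (I := 𝓘(ℝ, V)) hzt
  have hinv := isInvertible_mfderivWithin_extChartAt_symm (I := 𝓘(ℝ, V)) hzt
  have hU : UniqueMDiffWithinAt 𝓘(ℝ, V) (Set.range 𝓘(ℝ, V)) z :=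
    𝓘(ℝ, V).uniqueMDiffOn z (extChartAt_target_subset_range x hzt)
  have hcomp := mfderiv_comp_mfderivWithin z (hz.mdifferentiableAt (by simp)) hs hU
  have e1 : fderiv ℝ (F ∘ (extChartAt 𝓘(ℝ, V) x).symm) z =
      mfderivWithin 𝓘(ℝ, V) 𝓘(ℝ, W) (F ∘ (extChartAt 𝓘(ℝ, V) x).symm) (Set.range 𝓘(ℝ, V)) z := by
    rw [mfderivWithin_eq_fderivWithin]
    simp only [modelWithCornersSelf_coe, Set.range_id, fderivWithin_univ]
  have e2 := hinv.self_apply_inverse (X ((extChartAt 𝓘(ℝ, V) x).symm z))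
  rw [e1, hcomp]
  exact (congrArg (mvfderiv 𝓘(ℝ, V) F ((extChartAt 𝓘(ℝ, V) x).symm z)) e2).symm

lemma mdifferentiableAt_mvfderiv_vectorField [CompleteSpace V] {F : M → W} {x : M}
    (hF : ContMDiffAt 𝓘(ℝ, V) 𝓘(ℝ, W) 2 F x) {X : ∀ y : M, TangentSpace 𝓘(ℝ, V) y}
    (hX : MDiffAt (T% X) x) :
    MDifferentiableAt 𝓘(ℝ, V) 𝓘(ℝ, W) (fun y ↦ mvfderiv 𝓘(ℝ, V) F y (X y)) x := by
  have hFd : DifferentiableAt ℝ (fderiv ℝ (F ∘ (extChartAt 𝓘(ℝ, V) x).symm))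
      (extChartAt 𝓘(ℝ, V) x x) :=
    (hF.contDiffAt_comp_extChartAt_symm.fderiv_right (m := 1) (by norm_num)).differentiableAt
      (by simp)
  have hd := hFd.clm_apply (differentiableAt_vectorFieldInChart hX)
  have hd2 := hd.congr_of_eventuallyEq (eventually_mvfderiv_vectorField_eq hF X)
  have hd3 := hd2.mdifferentiableAt.comp x (mdifferentiableAt_extChartAt (mem_chart_source V x))
  refine hd3.congr_of_eventuallyEq ?_
  filter_upwards [extChartAt_source_mem_nhds (I := 𝓘(ℝ, V)) x] with y hy
  simp only [Function.comp_apply]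
  rw [(extChartAt 𝓘(ℝ, V) x).left_inv hy]

/-- The Lie bracket in terms of a vector-valued function `F`:
`D_[X,Y] F = D_X (D_Y F) - D_Y (D_X F)`. With an embedding or a chart for `F` this determines the
bracket by ordinary derivatives. -/
lemma mvfderiv_mlieBracket [CompleteSpace V] {F : M → W} {x : M}
    (hF : ContMDiffAt 𝓘(ℝ, V) 𝓘(ℝ, W) 2 F x) {X Y : ∀ y : M, TangentSpace 𝓘(ℝ, V) y}
    (hX : MDiffAt (T% X) x) (hY : MDiffAt (T% Y) x) :
    mvfderiv 𝓘(ℝ, V) F x (mlieBracket 𝓘(ℝ, V) X Y x) =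
      mvfderiv 𝓘(ℝ, V) (fun y ↦ mvfderiv 𝓘(ℝ, V) F y (Y y)) x (X x) -
      mvfderiv 𝓘(ℝ, V) (fun y ↦ mvfderiv 𝓘(ℝ, V) F y (X y)) x (Y x) := by
  have hF2 := hF.contDiffAt_comp_extChartAt_symm
  have hFd : DifferentiableAt ℝ (fderiv ℝ (F ∘ (extChartAt 𝓘(ℝ, V) x).symm))
      (extChartAt 𝓘(ℝ, V) x x) :=
    (hF2.fderiv_right (m := 1) (by norm_num)).differentiableAt (by simp)
  have key : ∀ X Y : ∀ y : M, TangentSpace 𝓘(ℝ, V) y, MDiffAt (T% Y) x →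
      mvfderiv 𝓘(ℝ, V) (fun y ↦ mvfderiv 𝓘(ℝ, V) F y (Y y)) x (X x) =
      fderiv ℝ (fderiv ℝ (F ∘ (extChartAt 𝓘(ℝ, V) x).symm)) (extChartAt 𝓘(ℝ, V) x x)
        (vectorFieldInChart X x (extChartAt 𝓘(ℝ, V) x x))
        (vectorFieldInChart Y x (extChartAt 𝓘(ℝ, V) x x)) +
      fderiv ℝ (F ∘ (extChartAt 𝓘(ℝ, V) x).symm) (extChartAt 𝓘(ℝ, V) x x)
        (fderiv ℝ (vectorFieldInChart Y x) (extChartAt 𝓘(ℝ, V) x x)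
          (vectorFieldInChart X x (extChartAt 𝓘(ℝ, V) x x))) := by
    intro X Y hY
    rw [(mdifferentiableAt_mvfderiv_vectorField hF hY).mvfderiv_eq_fderiv]
    have h := Filter.EventuallyEq.fderiv_eq (𝕜 := ℝ)
      (eventually_mvfderiv_vectorField_eq hF Y)
    rw [fderiv_clm_apply hFd (differentiableAt_vectorFieldInChart hY)] at h
    rw [← vectorFieldInChart_self X x]
    refine (congrArg (fun T : V →L[ℝ] W ↦
      T (vectorFieldInChart X x (extChartAt 𝓘(ℝ, V) x x))) h).trans ?_
    simp only [add_apply, ContinuousLinearMap.comp_apply, ContinuousLinearMap.flip_apply]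
    exact add_comm _ _
  -- the second derivative of `F` is symmetric, so that its contribution cancels
  have hsymm := (hF2.isSymmSndFDerivAt (by simp)).eq
    (vectorFieldInChart X x (extChartAt 𝓘(ℝ, V) x x))
    (vectorFieldInChart Y x (extChartAt 𝓘(ℝ, V) x x))
  rw [key X Y hY, key Y X hX, hsymm, (hF.mdifferentiableAt (by simp)).mvfderiv_eq_fderiv,
    mlieBracket_eq_lieBracket_vectorFieldInChart]
  refine (ContinuousLinearMap.map_sub (fderiv ℝ (F ∘ (extChartAt 𝓘(ℝ, V) x).symm)
    (extChartAt 𝓘(ℝ, V) x x)) _ _).trans ?_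
  abel

end

/-! ### Differentiability from inner products, and the Koszul formula -/

lemma ContinuousLinearMap.isInvertible_of_pos {V : Type*} [NormedAddCommGroup V] [NormedSpace ℝ V]
    [FiniteDimensional ℝ V] (T : V →L[ℝ] V →L[ℝ] ℝ) (h : ∀ a, a ≠ 0 → 0 < T a a) :
    T.IsInvertible := by
  have hinj : Function.Injective T := by
    refine (injective_iff_map_eq_zero T).2 fun a ha ↦ ?_
    by_contra hne
    have := h a hne
    simp [ha] at this
  have hfr : Module.finrank ℝ V = Module.finrank ℝ (V →L[ℝ] ℝ) :=
    (Subspace.dual_finrank_eq (K := ℝ) (V := V)).symm.trans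
      (LinearMap.toContinuousLinearMap (𝕜 := ℝ) (E := V) (F' := ℝ)).finrank_eq
  exact ⟨(LinearEquiv.ofInjectiveOfFinrankEq T.toLinearMap hinj hfr).toContinuousLinearEquiv,
    by ext; rfl⟩

section

variable {V : Type*} [NormedAddCommGroup V] [NormedSpace ℝ V] [FiniteDimensional ℝ V]
  {M : Type*} [TopologicalSpace M] [ChartedSpace V M] [IsManifold 𝓘(ℝ, V) ∞ M]

omit [FiniteDimensional ℝ V] in
/-- The local frame fields of the tangent bundle are differentiable. -/
lemma mdifferentiableAt_symm_trivialization (x : M) (v : V) :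
    MDifferentiableAt 𝓘(ℝ, V) (𝓘(ℝ, V).prod 𝓘(ℝ, V)) (fun y ↦ TotalSpace.mk' V y
      ((trivializationAt V (TangentSpace 𝓘(ℝ, V) : M → Type _) x).symmL ℝ y v)) x := by
  rw [mdifferentiableAt_section]
  refine (mdifferentiableAt_const (c := v)).congr_of_eventuallyEq ?_
  filter_upwards [(trivializationAt V (TangentSpace 𝓘(ℝ, V) : M → Type _) x).open_baseSet.mem_nhds
    (mem_baseSet_trivializationAt V (TangentSpace 𝓘(ℝ, V) : M → Type _) x)] with y hy
  rw [Trivialization.symmL_apply _ hy]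
  exact congrArg Prod.snd (Trivialization.apply_mk_symm _ hy v)

variable [RiemannianBundle (fun x : M ↦ TangentSpace 𝓘(ℝ, V) x)]
    [IsContMDiffRiemannianBundle 𝓘(ℝ, V) ∞ V (fun x : M ↦ TangentSpace 𝓘(ℝ, V) x)]

/-- A vector field is differentiable if its inner products with differentiable fields are: in a
trivialization it is the inverse of the Gram operator applied to its pairings with a local frame. -/
lemma mdifferentiableAt_vectorField_of_inner {σ : ∀ y : M, TangentSpace 𝓘(ℝ, V) y} {x : M}
    (h : ∀ τ : ∀ y : M, TangentSpace 𝓘(ℝ, V) y, MDiffAt (T% τ) x →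
      MDifferentiableAt 𝓘(ℝ, V) 𝓘(ℝ, ℝ) (fun y ↦ ⟪σ y, τ y⟫) x) :
    MDiffAt (T% σ) x := by
  let e := trivializationAt V (TangentSpace 𝓘(ℝ, V) : M → Type _) x
  have hx : x ∈ e.baseSet := mem_baseSet_trivializationAt V (TangentSpace 𝓘(ℝ, V) : M → Type _) x
  let G : M → V →L[ℝ] V →L[ℝ] ℝ := fun y ↦
    (innerSL ℝ (E := TangentSpace 𝓘(ℝ, V) y)).bilinearComp (e.symmL ℝ y) (e.symmL ℝ y)
  let θ : M → V →L[ℝ] ℝ := fun y ↦ (innerSL ℝ (E := TangentSpace 𝓘(ℝ, V) y) (σ y)) ∘L e.symmL ℝ y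
  have hG : MDifferentiableAt 𝓘(ℝ, V) 𝓘(ℝ, V →L[ℝ] V →L[ℝ] ℝ) G x :=
    mdifferentiableAt_clm_of_apply fun a ↦ mdifferentiableAt_clm_of_apply fun b ↦
      MDifferentiableAt.inner_bundle (F := V) (E := fun y : M ↦ TangentSpace 𝓘(ℝ, V) y)
        (b := fun y ↦ y) (mdifferentiableAt_symm_trivialization x a)
        (mdifferentiableAt_symm_trivialization x b)
  have hθ : MDifferentiableAt 𝓘(ℝ, V) 𝓘(ℝ, V →L[ℝ] ℝ) θ x :=
    mdifferentiableAt_clm_of_apply fun b ↦ h _ (mdifferentiableAt_symm_trivialization x b)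
  have hinv : ∀ y ∈ e.baseSet, (G y).IsInvertible := by
    intro y hy
    refine (G y).isInvertible_of_pos fun a ha ↦ ?_
    have hne : e.symmL ℝ y a ≠ 0 := by
      intro h0
      apply ha
      have := e.continuousLinearMapAt_symmL (R := ℝ) hy a
      rw [← this, h0, map_zero]
    exact real_inner_self_pos.2 hne
  rw [mdifferentiableAt_section]
  refine (MDifferentiableAt.bilin (ContinuousLinearMap.id ℝ _)
    (hG.clm_inverse (hinv x hx)) hθ).congr_of_eventuallyEq ?_
  filter_upwards [e.open_baseSet.mem_nhds hx] with y hy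
  refine (((hinv y hy).inverse_apply_eq).2 ?_).symm
  ext b
  change ⟪σ y, e.symmL ℝ y b⟫ = ⟪e.symmL ℝ y (e ⟨y, σ y⟩).2, e.symmL ℝ y b⟫
  congr 1
  have := e.symmL_continuousLinearMapAt (R := ℝ) hy (σ y)
  rw [← e.continuousLinearMapAt_apply_of_mem (R := ℝ) hy, this]

omit [IsContMDiffRiemannianBundle 𝓘(ℝ, V) ∞ V fun x : M ↦ TangentSpace 𝓘(ℝ, V) x] in
/-- The Koszul formula, at a point and for fields that are differentiable there. -/
lemma IsLeviCivita.koszul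
    {nabla : CovariantDerivative 𝓘(ℝ, V) V (TangentSpace 𝓘(ℝ, V) : M → Type _)}
    (hn : IsLeviCivita nabla) {X Y Z : ∀ y : M, TangentSpace 𝓘(ℝ, V) y} {x : M}
    (hX : MDiffAt (T% X) x) (hY : MDiffAt (T% Y) x) (hZ : MDiffAt (T% Z) x) :
    2 * ⟪nabla Y x (X x), Z x⟫ =
      mvfderiv 𝓘(ℝ, V) (fun y ↦ ⟪Y y, Z y⟫) x (X x) +
      mvfderiv 𝓘(ℝ, V) (fun y ↦ ⟪Z y, X y⟫) x (Y x) -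
      mvfderiv 𝓘(ℝ, V) (fun y ↦ ⟪X y, Y y⟫) x (Z x) +
      ⟪mlieBracket 𝓘(ℝ, V) X Y x, Z x⟫ - ⟪mlieBracket 𝓘(ℝ, V) X Z x, Y x⟫ -
      ⟪mlieBracket 𝓘(ℝ, V) Y Z x, X x⟫ := by
  have ht : ∀ {X Y : ∀ y : M, TangentSpace 𝓘(ℝ, V) y},
      MDiffAt (T% X) x → MDiffAt (T% Y) x →
      nabla Y x (X x) - nabla X x (Y x) = mlieBracket 𝓘(ℝ, V) X Y x :=
    (CovariantDerivative.torsion_eq_zero_iff nabla).1 hn.torsion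
  rw [hn.metric Y Z x hY hZ, hn.metric Z X x hZ hX, hn.metric X Y x hX hY, ← ht hX hY, ← ht hX hZ,
    ← ht hY hZ]
  simp only [inner_sub_left]
  rw [real_inner_comm (nabla Z x (X x)) (Y x), real_inner_comm (nabla X x (Y x)) (Z x),
    real_inner_comm (nabla Y x (Z x)) (X x)]
  ring

end

/-! ### Related vector fields -/

section

variable {V : Type*} [NormedAddCommGroup V] [NormedSpace ℝ V]
  {M : Type*} [TopologicalSpace M] [ChartedSpace V M]
  {V' : Type*} [NormedAddCommGroup V'] [NormedSpace ℝ V']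
  {B : Type*} [TopologicalSpace B] [ChartedSpace V' B]
  [IsManifold 𝓘(ℝ, V) ∞ M] [IsManifold 𝓘(ℝ, V') ∞ B]

/-- The image of a differentiable field under `dp` is differentiable as a field along `p`. -/
lemma MDifferentiableAt.mfderiv_vectorField {p : M → B} (hp : ContMDiff 𝓘(ℝ, V) 𝓘(ℝ, V') ∞ p)
    {X : ∀ y : M, TangentSpace 𝓘(ℝ, V) y} {x : M} (hX : MDiffAt (T% X) x) :
    MDifferentiableAt 𝓘(ℝ, V) (𝓘(ℝ, V').prod 𝓘(ℝ, V')) (fun y ↦ TotalSpace.mk'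
      (E := fun b : B ↦ TangentSpace 𝓘(ℝ, V') b) V' (p y)
      (mfderiv 𝓘(ℝ, V) 𝓘(ℝ, V') p y (X y))) x := by
  have h : ContMDiff _ _ 1 (tangentMap 𝓘(ℝ, V) 𝓘(ℝ, V') p) :=
    hp.contMDiff_tangentMap (by rw [one_add_one_eq_two]; exact ENat.LEInfty.out)
  exact MDifferentiableAt.comp x ((h _).mdifferentiableAt (by simp)) hX

/-- Brackets of `p`-related vector fields are `p`-related: by `mvfderiv_mlieBracket` for a chart `φ`
of the base and for `φ ∘ p`, both sides have the same image under the injective `dφ`. -/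
lemma mfderiv_mlieBracket_of_related [CompleteSpace V] [CompleteSpace V'] {p : M → B}
    (hp : ContMDiff 𝓘(ℝ, V) 𝓘(ℝ, V') ∞ p)
    {X Y : ∀ y : M, TangentSpace 𝓘(ℝ, V) y} {X' Y' : ∀ b : B, TangentSpace 𝓘(ℝ, V') b} {x : M}
    (hX : MDiffAt (T% X) x) (hY : MDiffAt (T% Y) x)
    (hX' : MDiffAt (T% X') (p x)) (hY' : MDiffAt (T% Y') (p x))
    (hXX' : ∀ y, mfderiv 𝓘(ℝ, V) 𝓘(ℝ, V') p y (X y) = X' (p y))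
    (hYY' : ∀ y, mfderiv 𝓘(ℝ, V) 𝓘(ℝ, V') p y (Y y) = Y' (p y)) :
    mfderiv 𝓘(ℝ, V) 𝓘(ℝ, V') p x (mlieBracket 𝓘(ℝ, V) X Y x) =
      mlieBracket 𝓘(ℝ, V') X' Y' (p x) := by
  have hpd : ∀ y, MDiffAt p y := fun y ↦ (hp y).mdifferentiableAt (by simp)
  have hφ2 : ContMDiffAt 𝓘(ℝ, V') 𝓘(ℝ, V') 2 (extChartAt 𝓘(ℝ, V') (p x)) (p x) :=
    contMDiffAt_extChartAt
  have hφ : MDiffAt (extChartAt 𝓘(ℝ, V') (p x)) (p x) := hφ2.mdifferentiableAt (by simp)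
  have hF : ContMDiffAt 𝓘(ℝ, V) 𝓘(ℝ, V') 2 (extChartAt 𝓘(ℝ, V') (p x) ∘ p) x :=
    hφ2.comp x ((hp x).of_le ENat.LEInfty.out)
  -- the derivative of the composite along a field is the derivative on the base, composed with `p`
  have hrel : ∀ (Z : ∀ y : M, TangentSpace 𝓘(ℝ, V) y) (Z' : ∀ b : B, TangentSpace 𝓘(ℝ, V') b),
      (∀ y, mfderiv 𝓘(ℝ, V) 𝓘(ℝ, V') p y (Z y) = Z' (p y)) →
      (fun y ↦ mvfderiv 𝓘(ℝ, V) (extChartAt 𝓘(ℝ, V') (p x) ∘ p) y (Z y)) =ᶠ[𝓝 x]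
      (fun b ↦ mvfderiv 𝓘(ℝ, V') (extChartAt 𝓘(ℝ, V') (p x)) b (Z' b)) ∘ p := by
    intro Z Z' hZ
    filter_upwards [hp.continuous.continuousAt.preimage_mem_nhds
      (extChartAt_source_mem_nhds (I := 𝓘(ℝ, V')) (p x))] with y hy
    rw [mvfderiv_comp_manifold_apply (mdifferentiableAt_extChartAt (by simpa using hy)) (hpd y),
      hZ]
    rfl
  have hbr := mvfderiv_mlieBracket hφ2 hX' hY'
  have hbr2 := mvfderiv_mlieBracket hF hX hY
  rw [mvfderiv_comp_manifold_apply hφ (hpd x), (hrel Y Y' hYY').mvfderiv_eq,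
    (hrel X X' hXX').mvfderiv_eq,
    mvfderiv_comp_manifold_apply (mdifferentiableAt_mvfderiv_vectorField hφ2 hY') (hpd x),
    mvfderiv_comp_manifold_apply (mdifferentiableAt_mvfderiv_vectorField hφ2 hX') (hpd x),
    hXX', hYY', ← hbr] at hbr2
  have hinj : Function.Injective (mvfderiv 𝓘(ℝ, V') (extChartAt 𝓘(ℝ, V') (p x)) (p x)) :=
    (isInvertible_mfderiv_extChartAt (mem_extChartAt_source (I := 𝓘(ℝ, V')) (p x))).injective
  exact hinj hbr2

end

/-! ### Horizontal lifts -/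

section

variable {V : Type*} [NormedAddCommGroup V] [NormedSpace ℝ V] [FiniteDimensional ℝ V]
  {M : Type*} [TopologicalSpace M] [ChartedSpace V M]
  [RiemannianBundle (fun x : M ↦ TangentSpace 𝓘(ℝ, V) x)]
  {V' : Type*} [NormedAddCommGroup V'] [NormedSpace ℝ V'] [FiniteDimensional ℝ V']
  {B : Type*} [TopologicalSpace B] [ChartedSpace V' B]
  [RiemannianBundle (fun b : B ↦ TangentSpace 𝓘(ℝ, V') b)]

namespace IsRiemannianSubmersion

variable {p : M → B} (hp : IsRiemannianSubmersion (V := V) (V' := V') p)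

include hp

lemma horizontalLift_mem (x : M) (v : TangentSpace 𝓘(ℝ, V') (p x)) :
    horizontalLift (V := V) p x v ∈ horizontalSpace (V := V) (V' := V') p x :=
  (horizontalLift_spec p x (hp.surjective_mfderiv x) v).1

lemma mfderiv_horizontalLift (x : M) (v : TangentSpace 𝓘(ℝ, V') (p x)) :
    mfderiv 𝓘(ℝ, V) 𝓘(ℝ, V') p x (horizontalLift (V := V) p x v) = v :=
  (horizontalLift_spec p x (hp.surjective_mfderiv x) v).2

lemma horizontalLift_mfderiv {x : M} {u : TangentSpace 𝓘(ℝ, V) x}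
    (hu : u ∈ horizontalSpace (V := V) (V' := V') p x) :
    horizontalLift (V := V) p x (mfderiv 𝓘(ℝ, V) 𝓘(ℝ, V') p x u) = u :=
  horizontalLift_unique p x _ _ (hp.horizontalLift_mem x _) hu (hp.mfderiv_horizontalLift x _)

/-- Taking horizontal lifts is adjoint to the differential of the submersion. -/
lemma inner_horizontalLift (x : M) (u : TangentSpace 𝓘(ℝ, V) x) (v : TangentSpace 𝓘(ℝ, V') (p x)) :
    ⟪u, horizontalLift (V := V) p x v⟫ = ⟪mfderiv 𝓘(ℝ, V) 𝓘(ℝ, V') p x u, v⟫ := by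
  obtain ⟨a, ha, b, hb, rfl⟩ := Submodule.exists_add_mem_mem_orthogonal
    (K := LinearMap.ker (mfderiv 𝓘(ℝ, V) 𝓘(ℝ, V') p x).toLinearMap) u
  have ha' : mfderiv 𝓘(ℝ, V) 𝓘(ℝ, V') p x a = 0 := ha
  have h := hp.inner_mfderiv x b hb _ (hp.horizontalLift_mem x v)
  rw [hp.mfderiv_horizontalLift] at h
  rw [inner_add_left, hp.horizontalLift_mem x v a ha, map_add, ha', zero_add, zero_add, h]

/-- The horizontal lift as a linear map. -/
noncomputable def liftLinear (x : M) :
    TangentSpace 𝓘(ℝ, V') (p x) →ₗ[ℝ] TangentSpace 𝓘(ℝ, V) x where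
  toFun := horizontalLift (V := V) p x
  map_add' v w := by
    refine ext_inner_left ℝ fun u ↦ ?_
    simp only [inner_add_right, hp.inner_horizontalLift]
  map_smul' c v := by
    refine ext_inner_left ℝ fun u ↦ ?_
    simp only [inner_smul_right, hp.inner_horizontalLift, RingHom.id_apply]

variable [IsManifold 𝓘(ℝ, V) ∞ M] [IsManifold 𝓘(ℝ, V') ∞ B]
    [IsContMDiffRiemannianBundle 𝓘(ℝ, V) ∞ V (fun x : M ↦ TangentSpace 𝓘(ℝ, V) x)]
    [IsContMDiffRiemannianBundle 𝓘(ℝ, V') ∞ V' (fun b : B ↦ TangentSpace 𝓘(ℝ, V') b)]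

/-- Horizontal lifts of differentiable fields are differentiable, because their inner product with
`τ` is the inner product of the given field with `dp τ`. -/
lemma mdifferentiableAt_horizontalLiftField {η : ∀ b : B, TangentSpace 𝓘(ℝ, V') b} {x : M}
    (hη : MDiffAt (T% η) (p x)) :
    MDifferentiableAt 𝓘(ℝ, V) (𝓘(ℝ, V).prod 𝓘(ℝ, V))
      (fun y ↦ TotalSpace.mk' V y (horizontalLiftField (V := V) p η y)) x := by
  refine mdifferentiableAt_vectorField_of_inner fun τ hτ ↦ ?_
  have h : (fun y ↦ ⟪horizontalLiftField (V := V) p η y, τ y⟫) =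
      fun y ↦ ⟪η (p y), mfderiv 𝓘(ℝ, V) 𝓘(ℝ, V') p y (τ y)⟫ := by
    funext y
    rw [real_inner_comm, horizontalLiftField, hp.inner_horizontalLift, real_inner_comm]
  rw [h]
  refine MDifferentiableAt.inner_bundle (F := V') (E := fun b : B ↦ TangentSpace 𝓘(ℝ, V') b)
    (b := p) ?_ (MDifferentiableAt.mfderiv_vectorField hp.contMDiff hτ)
  exact MDifferentiableAt.comp x hη ((hp.contMDiff x).mdifferentiableAt (by simp))

/-- The horizontal part of `∇ᴹ` on lifted fields is `∇ᴮ`: every term of the Koszul formula on `M`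
for horizontal lifts is the corresponding term on `B`. -/
lemma inner_nabla_horizontalLift
    {nablaM : CovariantDerivative 𝓘(ℝ, V) V (TangentSpace 𝓘(ℝ, V) : M → Type _)}
    {nablaB : CovariantDerivative 𝓘(ℝ, V') V' (TangentSpace 𝓘(ℝ, V') : B → Type _)}
    (hM : IsLeviCivita nablaM) (hB : IsLeviCivita nablaB)
    {η : ∀ b : B, TangentSpace 𝓘(ℝ, V') b} {x : M}
    (hη : MDiffAt (T% η) (p x)) (v w : TangentSpace 𝓘(ℝ, V') (p x)) :
    ⟪nablaM (horizontalLiftField p η) x (horizontalLift (V := V) p x v),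
      horizontalLift (V := V) p x w⟫ = ⟪nablaB η (p x) v, w⟫ := by
  -- `v` and `w` are extended to differentiable fields, to which the Koszul formula applies
  let ξ : ∀ b : B, TangentSpace 𝓘(ℝ, V') b := FiberBundle.extend V' v
  let ζ : ∀ b : B, TangentSpace 𝓘(ℝ, V') b := FiberBundle.extend V' w
  have hξ : MDiffAt (T% ξ) (p x) := FiberBundle.mdifferentiableAt_extend ..
  have hζ : MDiffAt (T% ζ) (p x) := FiberBundle.mdifferentiableAt_extend ..
  have hξx : ξ (p x) = v := FiberBundle.extend_apply_self ..
  have hζx : ζ (p x) = w := FiberBundle.extend_apply_self ..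
  have kM := hM.koszul (hp.mdifferentiableAt_horizontalLiftField hξ)
    (hp.mdifferentiableAt_horizontalLiftField hη) (hp.mdifferentiableAt_horizontalLiftField hζ)
  have kB := hB.koszul hξ hη hζ
  have hd : ∀ α β γ : ∀ b : B, TangentSpace 𝓘(ℝ, V') b, MDiffAt (T% α) (p x) →
      MDiffAt (T% β) (p x) →
      mvfderiv 𝓘(ℝ, V) (fun y ↦ ⟪horizontalLiftField (V := V) p α y,
        horizontalLiftField (V := V) p β y⟫) x (horizontalLiftField (V := V) p γ x) =
      mvfderiv 𝓘(ℝ, V') (fun b ↦ ⟪α b, β b⟫) (p x) (γ (p x)) := by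
    intro α β γ hα hβ
    have h : (fun y ↦ ⟪horizontalLiftField (V := V) p α y,
        horizontalLiftField (V := V) p β y⟫) = (fun b ↦ ⟪α b, β b⟫) ∘ p := by
      funext y
      simp only [horizontalLiftField, hp.inner_horizontalLift, hp.mfderiv_horizontalLift,
        Function.comp_apply]
    rw [h, mvfderiv_comp_manifold_apply (MDifferentiableAt.inner_bundle (F := V')
      (E := fun b : B ↦ TangentSpace 𝓘(ℝ, V') b) (b := fun b ↦ b) hα hβ)
      ((hp.contMDiff x).mdifferentiableAt (by simp)), horizontalLiftField,
      hp.mfderiv_horizontalLift]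
  have hbr : ∀ α β γ : ∀ b : B, TangentSpace 𝓘(ℝ, V') b, MDiffAt (T% α) (p x) →
      MDiffAt (T% β) (p x) →
      ⟪mlieBracket 𝓘(ℝ, V) (horizontalLiftField (V := V) p α) (horizontalLiftField (V := V) p β) x,
        horizontalLiftField (V := V) p γ x⟫ = ⟪mlieBracket 𝓘(ℝ, V') α β (p x), γ (p x)⟫ := by
    intro α β γ hα hβ
    rw [horizontalLiftField, hp.inner_horizontalLift, mfderiv_mlieBracket_of_related hp.contMDiff
      (hp.mdifferentiableAt_horizontalLiftField hα) (hp.mdifferentiableAt_horizontalLiftField hβ)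
      hα hβ (fun y ↦ hp.mfderiv_horizontalLift y _) (fun y ↦ hp.mfderiv_horizontalLift y _)]
  rw [hd η ζ ξ hη hζ, hd ζ ξ η hζ hξ, hd ξ η ζ hξ hη, hbr ξ η ζ hξ hη, hbr ξ ζ η hξ hζ,
    hbr η ζ ξ hη hζ, ← kB] at kM
  have h := mul_left_cancel₀ two_ne_zero kM
  simpa only [horizontalLiftField, hξx, hζx] using h

end IsRiemannianSubmersion

end

/-! ### Metric projections -/

section

variable {E : Type*} [NormedAddCommGroup E] [InnerProductSpace ℝ E] [FiniteDimensional ℝ E]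

lemma metricProjection_congr {A : E →L[ℝ] E} {W : Submodule ℝ E}
    (hs : ∀ a b : E, ⟪A a, b⟫ = ⟪a, A b⟫) (hp : ∀ a : E, a ≠ 0 → 0 < ⟪a, A a⟫)
    {e e' : E} (h : ∀ w ∈ W, ⟪e, A w⟫ = ⟪e', A w⟫) :
    metricProjection A W e = metricProjection A W e' :=
  eq_metricProjection A W hs hp _ _ (metricProjection_mem A W e) fun w hw ↦
    (inner_metricProjection A W hs hp e w hw).trans (h w hw)

lemma metricProjection_eq_self {A : E →L[ℝ] E} {W : Submodule ℝ E}
    (hs : ∀ a b : E, ⟪A a, b⟫ = ⟪a, A b⟫) (hp : ∀ a : E, a ≠ 0 → 0 < ⟪a, A a⟫)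
    {e : E} (he : e ∈ W) : metricProjection A W e = e :=
  (eq_metricProjection A W hs hp e e he fun _ _ ↦ rfl).symm

lemma ContinuousLinearMap.isInvertible_of_inner_pos {A : E →L[ℝ] E}
    (hp : ∀ a : E, a ≠ 0 → 0 < ⟪a, A a⟫) : A.IsInvertible := by
  have hinj : Function.Injective A := by
    refine (injective_iff_map_eq_zero A).2 fun a ha ↦ ?_
    by_contra hne
    have := hp a hne
    simp [ha] at this
  exact ⟨(LinearEquiv.ofInjectiveEndo A.toLinearMap hinj).toContinuousLinearEquiv, by ext; rfl⟩

variable {V : Type*} [NormedAddCommGroup V] [NormedSpace ℝ V]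
  {M : Type*} [TopologicalSpace M] [ChartedSpace V M]
  {V' : Type*} [NormedAddCommGroup V'] [NormedSpace ℝ V'] [FiniteDimensional ℝ V']

/-- If the subspaces are the ranges of differentiable injective families, the metric projections
are differentiable. -/
lemma mdifferentiableAt_metricProjection {g : M → E →L[ℝ] E} {N : M → V' →L[ℝ] E}
    {W : M → Submodule ℝ E} {x : M}
    (hg : MDifferentiableAt 𝓘(ℝ, V) 𝓘(ℝ, E →L[ℝ] E) g x)
    (hN : MDifferentiableAt 𝓘(ℝ, V) 𝓘(ℝ, V' →L[ℝ] E) N x)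
    (hs : ∀ y, ∀ a b : E, ⟪g y a, b⟫ = ⟪a, g y b⟫) (hp : ∀ y, ∀ a : E, a ≠ 0 → 0 < ⟪a, g y a⟫)
    (hW : ∀ᶠ y in 𝓝 x, Function.Injective (N y) ∧ LinearMap.range (N y).toLinearMap = W y) :
    MDifferentiableAt 𝓘(ℝ, V) 𝓘(ℝ, E →L[ℝ] E) (fun y ↦ metricProjection (g y) (W y)) x := by
  have happ : ∀ b, MDifferentiableAt 𝓘(ℝ, V) 𝓘(ℝ, E) (fun y ↦ N y b) x := fun b ↦
    hN.clm_apply_apply mdifferentiableAt_const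
  have happg : ∀ b, MDifferentiableAt 𝓘(ℝ, V) 𝓘(ℝ, E) (fun y ↦ g y (N y b)) x := fun b ↦
    hg.clm_apply_apply (happ b)
  -- in terms of the parametrization `N` the projection is `N G⁻¹ S`, with `G` the Gram operator
  let G : M → V' →L[ℝ] V' →L[ℝ] ℝ := fun y ↦ (innerSL ℝ).bilinearComp (N y) (g y ∘L N y)
  have hG : MDifferentiableAt 𝓘(ℝ, V) 𝓘(ℝ, V' →L[ℝ] V' →L[ℝ] ℝ) G x :=
    mdifferentiableAt_clm_of_apply fun a ↦ mdifferentiableAt_clm_of_apply fun b ↦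
      (happ a).inner_apply (happg b)
  have hinv : ∀ y, Function.Injective (N y) → (G y).IsInvertible := fun y hy ↦
    (G y).isInvertible_of_pos fun a ha ↦ hp y _ (by simpa using hy.ne ha)
  refine mdifferentiableAt_clm_of_apply fun e ↦ ?_
  let S : M → V' →L[ℝ] ℝ := fun y ↦ innerSL ℝ e ∘L g y ∘L N y
  have hS : MDifferentiableAt 𝓘(ℝ, V) 𝓘(ℝ, V' →L[ℝ] ℝ) S x :=
    mdifferentiableAt_clm_of_apply fun b ↦ mdifferentiableAt_const.inner_apply (happg b)
  refine (hN.clm_apply_apply ((hG.clm_inverse (hinv x hW.self_of_nhds.1)).clm_apply_apply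
    hS)).congr_of_eventuallyEq ?_
  filter_upwards [hW] with y hy
  refine (eq_metricProjection (g y) (W y) (hs y) (hp y) e _ ?_ ?_).symm
  · rw [← hy.2]
    exact ⟨_, rfl⟩
  · rw [← hy.2]
    rintro _ ⟨b, rfl⟩
    exact congrArg (fun T : V' →L[ℝ] ℝ ↦ T b) ((hinv y hy.1).self_apply_inverse (S y))

end

/-! ### The connection of an embedded manifold -/

section

variable {E : Type*} [NormedAddCommGroup E] [InnerProductSpace ℝ E]
  {V : Type*} [NormedAddCommGroup V] [NormedSpace ℝ V]
  {M : Type*} [TopologicalSpace M] [ChartedSpace V M]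
  [RiemannianBundle (fun x : M ↦ TangentSpace 𝓘(ℝ, V) x)]

namespace IsEmbeddedAmbientStructure

variable {ι : M → E} {g : M → E →L[ℝ] E} (hM : IsEmbeddedAmbientStructure (V := V) ι g)

include hM

lemma mdifferentiableAt_metric (x : M) : MDifferentiableAt 𝓘(ℝ, V) 𝓘(ℝ, E →L[ℝ] E) g x :=
  (hM.contMDiff_metric x).mdifferentiableAt (by simp)

lemma injective_mvfderiv (x : M) : Function.Injective (mvfderiv 𝓘(ℝ, V) ι x) := by
  refine (injective_iff_map_eq_zero _).2 fun u hu ↦ ?_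
  have h := hM.inner_eq x u u
  rw [hu, inner_zero_left] at h
  exact inner_self_eq_zero.1 h

lemma inner_mvfderiv_metric_apply (x : M) (w : TangentSpace 𝓘(ℝ, V) x) (a b : E) :
    ⟪mvfderiv 𝓘(ℝ, V) g x w a, b⟫ = ⟪a, mvfderiv 𝓘(ℝ, V) g x w b⟫ := by
  have hg := hM.mdifferentiableAt_metric x
  have hc : ∀ c : E, MDifferentiableAt 𝓘(ℝ, V) 𝓘(ℝ, E) (fun _ : M ↦ c) x :=
    fun _ ↦ mdifferentiableAt_const
  have h1 : ∀ c : E, mvfderiv 𝓘(ℝ, V) (fun y ↦ g y c) x w = mvfderiv 𝓘(ℝ, V) g x w c := by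
    intro c
    simpa [mvfderiv_const] using hg.mvfderiv_clm_apply_apply (hc c) w
  have hgc : ∀ c : E, MDifferentiableAt 𝓘(ℝ, V) 𝓘(ℝ, E) (fun y : M ↦ g y c) x :=
    fun c ↦ hg.clm_apply_apply (hc c)
  have h2 := (hgc a).mvfderiv_inner_apply (hc b) w
  have h3 := (hc a).mvfderiv_inner_apply (hgc b) w
  simp only [mvfderiv_const, h1, zero_apply, inner_zero_left, inner_zero_right,
    add_zero, zero_add] at h2 h3
  rw [← h2, ← h3]
  congr 2
  funext y
  exact hM.metric_symm y a b

variable [FiniteDimensional ℝ V] [IsManifold 𝓘(ℝ, V) ∞ M]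

lemma mdifferentiableAt_mvfderiv {X : ∀ y : M, TangentSpace 𝓘(ℝ, V) y} {x : M}
    (hX : MDiffAt (T% X) x) :
    MDifferentiableAt 𝓘(ℝ, V) 𝓘(ℝ, E) (fun y ↦ mvfderiv 𝓘(ℝ, V) ι y (X y)) x :=
  mdifferentiableAt_mvfderiv_vectorField
    ((hM.isSmoothEmbedding.contMDiff x).of_le ENat.LEInfty.out) hX

/-- The product rule for the metric induced by `g`. -/
lemma mvfderiv_inner {X Y : ∀ y : M, TangentSpace 𝓘(ℝ, V) y} {x : M}
    (hX : MDiffAt (T% X) x) (hY : MDiffAt (T% Y) x) (u : TangentSpace 𝓘(ℝ, V) x) :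
    mvfderiv 𝓘(ℝ, V) (fun y ↦ ⟪X y, Y y⟫) x u =
      ⟪mvfderiv 𝓘(ℝ, V) (fun y ↦ mvfderiv 𝓘(ℝ, V) ι y (X y)) x u,
        g x (mvfderiv 𝓘(ℝ, V) ι x (Y x))⟫ +
      (⟪mvfderiv 𝓘(ℝ, V) ι x (X x), mvfderiv 𝓘(ℝ, V) g x u (mvfderiv 𝓘(ℝ, V) ι x (Y x))⟫ +
      ⟪mvfderiv 𝓘(ℝ, V) ι x (X x),
        g x (mvfderiv 𝓘(ℝ, V) (fun y ↦ mvfderiv 𝓘(ℝ, V) ι y (Y y)) x u)⟫) := by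
  have hX' := hM.mdifferentiableAt_mvfderiv hX
  have hY' := hM.mdifferentiableAt_mvfderiv hY
  have hg := hM.mdifferentiableAt_metric x
  have h3 : (fun y ↦ ⟪X y, Y y⟫) = fun y ↦
      ⟪mvfderiv 𝓘(ℝ, V) ι y (X y), g y (mvfderiv 𝓘(ℝ, V) ι y (Y y))⟫ := by
    funext y
    exact hM.inner_eq y _ _
  rw [h3, hX'.mvfderiv_inner_apply (hg.clm_apply_apply hY'), hg.mvfderiv_clm_apply_apply hY',
    inner_add_right]

/-- The Koszul formula in ambient terms: `∇_u η` and `D_u η + g⁻¹ K(u, η)` have the same inner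
products, for the metric given by `g`, with tangent vectors. In the Koszul formula the brackets are
those of `mvfderiv_mlieBracket` for the embedding, and all derivatives of fields other than `D_u η`
cancel. -/
lemma inner_mvfderiv_nabla
    {nabla : CovariantDerivative 𝓘(ℝ, V) V (TangentSpace 𝓘(ℝ, V) : M → Type _)}
    (hn : IsLeviCivita nabla)
    {X : ∀ Y : M, TangentSpace 𝓘(ℝ, V) Y →ₗ[ℝ] TangentSpace 𝓘(ℝ, V) Y →ₗ[ℝ] E}
    (hX : IsIndexRaisingTerm (V := V) ι g X)
    {η : ∀ y : M, TangentSpace 𝓘(ℝ, V) y} {x : M} (hη : MDiffAt (T% η) x)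
    (u w : TangentSpace 𝓘(ℝ, V) x) :
    ⟪mvfderiv 𝓘(ℝ, V) ι x (nabla η x u), g x (mvfderiv 𝓘(ℝ, V) ι x w)⟫ =
      ⟪mvfderiv 𝓘(ℝ, V) (fun y ↦ mvfderiv 𝓘(ℝ, V) ι y (η y)) x u,
        g x (mvfderiv 𝓘(ℝ, V) ι x w)⟫ +
      ⟪christoffelMetricTerm ι g X x u (η x), mvfderiv 𝓘(ℝ, V) ι x w⟫ := by
  -- `u` and `w` are extended to differentiable fields, to which the Koszul formula applies
  let ξ : ∀ y : M, TangentSpace 𝓘(ℝ, V) y := FiberBundle.extend V u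
  let ζ : ∀ y : M, TangentSpace 𝓘(ℝ, V) y := FiberBundle.extend V w
  have hξ : MDiffAt (T% ξ) x := FiberBundle.mdifferentiableAt_extend ..
  have hζ : MDiffAt (T% ζ) x := FiberBundle.mdifferentiableAt_extend ..
  have hξx : ξ x = u := FiberBundle.extend_apply_self ..
  have hζx : ζ x = w := FiberBundle.extend_apply_self ..
  have hι : ContMDiffAt 𝓘(ℝ, V) 𝓘(ℝ, E) 2 ι x :=
    (hM.isSmoothEmbedding.contMDiff x).of_le ENat.LEInfty.out
  have k := hn.koszul hξ hη hζ
  rw [hM.mvfderiv_inner hη hζ, hM.mvfderiv_inner hζ hξ, hM.mvfderiv_inner hξ hη] at k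
  simp only [hM.inner_eq x, mvfderiv_mlieBracket hι hξ hη, mvfderiv_mlieBracket hι hξ hζ,
    mvfderiv_mlieBracket hι hη hζ, hξx, hζx, inner_sub_left] at k
  have hXw := hX x u (η x) w
  simp only [christoffelMetricTerm, inner_smul_left, inner_sub_left, inner_add_left, hXw,
    hM.inner_mvfderiv_metric_apply]
  have hc : ∀ a b : E, ⟪a, g x b⟫ = ⟪b, g x a⟫ := fun a b ↦ by
    rw [← hM.metric_symm, real_inner_comm]
  have hc' : ∀ (t : TangentSpace 𝓘(ℝ, V) x) (a b : E),
      ⟪a, mvfderiv 𝓘(ℝ, V) g x t b⟫ = ⟪b, mvfderiv 𝓘(ℝ, V) g x t a⟫ := fun t a b ↦ by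
    rw [← hM.inner_mvfderiv_metric_apply, real_inner_comm]
  rw [hc (mvfderiv 𝓘(ℝ, V) ι x (η x)), hc (mvfderiv 𝓘(ℝ, V) ι x w) (mvfderiv 𝓘(ℝ, V) _ x _),
    hc (mvfderiv 𝓘(ℝ, V) ι x u)] at k
  rw [hc' (η x) _ (mvfderiv 𝓘(ℝ, V) ι x w)]
  simp only [conj_trivial]
  linarith
end IsEmbeddedAmbientStructure

end

/-! ### The horizontal part of the connection -/

section

variable {E : Type*} [NormedAddCommGroup E] [InnerProductSpace ℝ E] [FiniteDimensional ℝ E]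
  {V : Type*} [NormedAddCommGroup V] [NormedSpace ℝ V]
  {M : Type*} [TopologicalSpace M] [ChartedSpace V M]
  [RiemannianBundle (fun x : M ↦ TangentSpace 𝓘(ℝ, V) x)]

namespace IsEmbeddedAmbientStructure

variable {ι : M → E} {g : M → E →L[ℝ] E} (hM : IsEmbeddedAmbientStructure (V := V) ι g)

include hM

/-- An index-raising term is obtained by extending `w ↦ ⟪u, (D_w g) v⟫` from the tangent space to
`E` by means of a left inverse of the differential of the embedding. -/
lemma exists_isIndexRaisingTerm : ∃ X, IsIndexRaisingTerm (V := V) ι g X := by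
  have hS : ∀ Y : M, ∃ S : E →ₗ[ℝ] TangentSpace 𝓘(ℝ, V) Y,
      S ∘ₗ (mvfderiv 𝓘(ℝ, V) ι Y).toLinearMap = LinearMap.id := fun Y ↦
    LinearMap.exists_leftInverse_of_injective _ (LinearMap.ker_eq_bot.2 (hM.injective_mvfderiv Y))
  choose S hS using hS
  let b := stdOrthonormalBasis ℝ E
  refine ⟨fun Y ↦ LinearMap.mk₂ ℝ (fun u v ↦ ∑ i, ⟪mvfderiv 𝓘(ℝ, V) ι Y u,
      mvfderiv 𝓘(ℝ, V) g Y (S Y (b i)) (mvfderiv 𝓘(ℝ, V) ι Y v)⟫ • b i) ?_ ?_ ?_ ?_, ?_⟩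
  · intro u u' v
    simp only [map_add, inner_add_left, add_smul, Finset.sum_add_distrib]
  · intro c u v
    simp only [map_smul, real_inner_smul_left, mul_smul, Finset.smul_sum]
  · intro u v v'
    simp only [map_add, inner_add_right, add_smul, Finset.sum_add_distrib]
  · intro c u v
    simp only [map_smul, real_inner_smul_right, mul_smul, Finset.smul_sum]
  · intro Y u v w
    have hw : S Y (mvfderiv 𝓘(ℝ, V) ι Y w) = w := LinearMap.congr_fun (hS Y) w
    have hexp := congrArg (S Y) (b.sum_repr' (mvfderiv 𝓘(ℝ, V) ι Y w))
    rw [hw] at hexp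
    rw [LinearMap.mk₂_apply, sum_inner]
    conv_rhs => rw [← hexp]
    simp only [map_sum, map_smul, sum_apply, smul_apply, inner_sum, real_inner_smul_right,
      real_inner_smul_left]
    exact Finset.sum_congr rfl fun i _ ↦ mul_comm _ _

variable [FiniteDimensional ℝ V]
  {V' : Type*} [NormedAddCommGroup V'] [NormedSpace ℝ V'] [FiniteDimensional ℝ V']
  {B : Type*} [TopologicalSpace B] [ChartedSpace V' B]
  [RiemannianBundle (fun b : B ↦ TangentSpace 𝓘(ℝ, V') b)]
  [IsManifold 𝓘(ℝ, V) ∞ M] [IsManifold 𝓘(ℝ, V') ∞ B]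
  [IsContMDiffRiemannianBundle 𝓘(ℝ, V) ∞ V (fun x : M ↦ TangentSpace 𝓘(ℝ, V) x)]
  [IsContMDiffRiemannianBundle 𝓘(ℝ, V') ∞ V' (fun b : B ↦ TangentSpace 𝓘(ℝ, V') b)]
  {p : M → B} (hp : IsRiemannianSubmersion (V := V) (V' := V') p)

include hp

/-- The projection to the horizontal spaces is differentiable: these are spanned by the lifts of a
local frame of the base. -/
lemma mdifferentiableAt_bundleProjection_horizontalSpace (x : M) :
    MDifferentiableAt 𝓘(ℝ, V) 𝓘(ℝ, E →L[ℝ] E)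
      (bundleProjection ι g (horizontalSpace (V := V) (V' := V') p)) x := by
  let e := trivializationAt V' (TangentSpace 𝓘(ℝ, V') : B → Type _) (p x)
  have hx : p x ∈ e.baseSet :=
    mem_baseSet_trivializationAt V' (TangentSpace 𝓘(ℝ, V') : B → Type _) (p x)
  let N : M → V' →L[ℝ] E := fun y ↦ LinearMap.toContinuousLinearMap
    ((mvfderiv 𝓘(ℝ, V) ι y).toLinearMap ∘ₗ hp.liftLinear y ∘ₗ (e.symmL ℝ (p y)).toLinearMap)
  have hN : MDifferentiableAt 𝓘(ℝ, V) 𝓘(ℝ, V' →L[ℝ] E) N x :=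
    mdifferentiableAt_clm_of_apply fun v ↦ hM.mdifferentiableAt_mvfderiv
      (hp.mdifferentiableAt_horizontalLiftField (mdifferentiableAt_symm_trivialization (p x) v))
  refine mdifferentiableAt_metricProjection (hM.mdifferentiableAt_metric x) hN hM.metric_symm
    hM.metric_pos ?_
  filter_upwards [hp.contMDiff.continuous.continuousAt.preimage_mem_nhds
    (e.open_baseSet.mem_nhds hx)] with y hy
  constructor
  · intro a b hab
    have h1 := hM.injective_mvfderiv y hab
    have h2 := congrArg (mfderiv 𝓘(ℝ, V) 𝓘(ℝ, V') p y) h1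
    have h3 : e.symmL ℝ (p y) a = e.symmL ℝ (p y) b :=
      (hp.mfderiv_horizontalLift y _).symm.trans (h2.trans (hp.mfderiv_horizontalLift y _))
    rw [← e.continuousLinearMapAt_symmL (R := ℝ) hy a, h3,
      e.continuousLinearMapAt_symmL (R := ℝ) hy b]
  · apply le_antisymm
    · rintro _ ⟨a, rfl⟩
      exact ⟨_, hp.horizontalLift_mem y _, rfl⟩
    · rintro _ ⟨u, hu, rfl⟩
      refine ⟨e.continuousLinearMapAt ℝ (p y) (mfderiv 𝓘(ℝ, V) 𝓘(ℝ, V') p y u), ?_⟩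
      change mvfderiv 𝓘(ℝ, V) ι y (horizontalLift p y (e.symmL ℝ (p y)
        (e.continuousLinearMapAt ℝ (p y) (mfderiv 𝓘(ℝ, V) 𝓘(ℝ, V') p y u)))) =
          mvfderiv 𝓘(ℝ, V) ι y u
      rw [e.symmL_continuousLinearMapAt (R := ℝ) hy, hp.horizontalLift_mfderiv hu]

/-- The horizontal part of the covariant derivative of a horizontal field is given by the
Christoffel function. By the ambient Koszul formula it is `Π (D_u η + g⁻¹ K(u, η))`, and
`Π (D_u η) = D_u η - (D_u Π) η` by differentiation of `Π η = η`. -/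
lemma bundleProjection_nabla_eq
    {nabla : CovariantDerivative 𝓘(ℝ, V) V (TangentSpace 𝓘(ℝ, V) : M → Type _)}
    (hn : IsLeviCivita nabla)
    {X : ∀ Y : M, TangentSpace 𝓘(ℝ, V) Y →ₗ[ℝ] TangentSpace 𝓘(ℝ, V) Y →ₗ[ℝ] E}
    (hX : IsIndexRaisingTerm (V := V) ι g X)
    {η : ∀ y : M, TangentSpace 𝓘(ℝ, V) y} {x : M} (hη : MDiffAt (T% η) x)
    (hηH : ∀ y, η y ∈ horizontalSpace (V := V) (V' := V') p y)
    (u : TangentSpace 𝓘(ℝ, V) x) :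
    bundleProjection ι g (horizontalSpace (V := V) (V' := V') p) x
        (mvfderiv 𝓘(ℝ, V) ι x (nabla η x u)) =
      mvfderiv 𝓘(ℝ, V) (fun y ↦ mvfderiv 𝓘(ℝ, V) ι y (η y)) x u +
        christoffelFunction ι g X (horizontalSpace (V := V) (V' := V') p) x u (η x) := by
  have hη' := hM.mdifferentiableAt_mvfderiv hη
  have hP := hM.mdifferentiableAt_bundleProjection_horizontalSpace hp x
  -- differentiate the identity `Π η = η`
  have hfix : (fun y ↦ bundleProjection ι g (horizontalSpace (V := V) (V' := V') p) y
      (mvfderiv 𝓘(ℝ, V) ι y (η y))) = fun y ↦ mvfderiv 𝓘(ℝ, V) ι y (η y) := by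
    funext y
    exact metricProjection_eq_self (hM.metric_symm y) (hM.metric_pos y) ⟨_, hηH y, rfl⟩
  have hd := hP.mvfderiv_clm_apply_apply hη' u
  rw [hfix] at hd
  have hproj : bundleProjection ι g (horizontalSpace (V := V) (V' := V') p) x
        (mvfderiv 𝓘(ℝ, V) ι x (nabla η x u)) =
      bundleProjection ι g (horizontalSpace (V := V) (V' := V') p) x
        (mvfderiv 𝓘(ℝ, V) (fun y ↦ mvfderiv 𝓘(ℝ, V) ι y (η y)) x u +
          (g x).inverse (christoffelMetricTerm ι g X x u (η x))) := by
    refine metricProjection_congr (hM.metric_symm x) (hM.metric_pos x) ?_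
    rintro _ ⟨w, -, rfl⟩
    have hinv := (ContinuousLinearMap.isInvertible_of_inner_pos
      (hM.metric_pos x)).self_apply_inverse (christoffelMetricTerm ι g X x u (η x))
    rw [inner_add_left, ← hM.metric_symm x ((g x).inverse _), hinv]
    exact hM.inner_mvfderiv_nabla hn hX hη u w
  rw [hproj, map_add, christoffelFunction]
  nth_rewrite 2 [hd]
  abel

/-- The Levi-Civita connection of the base lifts to the horizontal part of the one of `M`. Both
sides are horizontal and have the same inner products with horizontal vectors. -/
lemma mvfderiv_horizontalLift_nabla
    {nablaM : CovariantDerivative 𝓘(ℝ, V) V (TangentSpace 𝓘(ℝ, V) : M → Type _)}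
    {nablaB : CovariantDerivative 𝓘(ℝ, V') V' (TangentSpace 𝓘(ℝ, V') : B → Type _)}
    (hnM : IsLeviCivita nablaM) (hnB : IsLeviCivita nablaB)
    {η : ∀ b : B, TangentSpace 𝓘(ℝ, V') b} {x : M}
    (hη : MDiffAt (T% η) (p x)) (v : TangentSpace 𝓘(ℝ, V') (p x)) :
    mvfderiv 𝓘(ℝ, V) ι x (horizontalLift p x (nablaB η (p x) v)) =
      bundleProjection ι g (horizontalSpace (V := V) (V' := V') p) x (mvfderiv 𝓘(ℝ, V) ι x
        (nablaM (horizontalLiftField p η) x (horizontalLift p x v))) := by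
  refine eq_metricProjection _ _ (hM.metric_symm x) (hM.metric_pos x) _ _
    ⟨_, hp.horizontalLift_mem x _, rfl⟩ ?_
  rintro _ ⟨h, hh, rfl⟩
  refine (hM.inner_eq x _ _).symm.trans (Eq.trans ?_ (hM.inner_eq x _ _))
  rw [real_inner_comm, hp.inner_horizontalLift, real_inner_comm,
    ← hp.inner_nabla_horizontalLift hnM hnB hη, hp.horizontalLift_mfderiv hh]

end IsEmbeddedAmbientStructure

end

/-! ### Gradients -/

section

variable {V : Type*} [NormedAddCommGroup V] [NormedSpace ℝ V] [FiniteDimensional ℝ V]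
  {M : Type*} [TopologicalSpace M] [ChartedSpace V M]
  [RiemannianBundle (fun x : M ↦ TangentSpace 𝓘(ℝ, V) x)]

lemma inner_riemannianGradient (f : M → ℝ) (x : M) (v : TangentSpace 𝓘(ℝ, V) x) :
    ⟪riemannianGradient (V := V) f x, v⟫ = mvfderiv 𝓘(ℝ, V) f x v :=
  InnerProductSpace.toDual_symm_apply

lemma subbundleGradient_mem (H : ∀ x : M, Submodule ℝ (TangentSpace 𝓘(ℝ, V) x)) (f : M → ℝ)
    (x : M) : subbundleGradient H f x ∈ H x :=
  Subtype.property _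

lemma inner_subbundleGradient (H : ∀ x : M, Submodule ℝ (TangentSpace 𝓘(ℝ, V) x)) (f : M → ℝ)
    (x : M) {v : TangentSpace 𝓘(ℝ, V) x} (hv : v ∈ H x) :
    ⟪subbundleGradient H f x, v⟫ = mvfderiv 𝓘(ℝ, V) f x v :=
  InnerProductSpace.toDual_symm_apply (𝕜 := ℝ) (E := H x) (x := ⟨v, hv⟩)
    (y := (mvfderiv 𝓘(ℝ, V) f x).comp (H x).subtypeL)

lemma mdifferentiableAt_riemannianGradient [IsManifold 𝓘(ℝ, V) ∞ M]
    [IsContMDiffRiemannianBundle 𝓘(ℝ, V) ∞ V (fun x : M ↦ TangentSpace 𝓘(ℝ, V) x)]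
    {f : M → ℝ} {x : M} (hf : ContMDiffAt 𝓘(ℝ, V) 𝓘(ℝ, ℝ) 2 f x) :
    MDifferentiableAt 𝓘(ℝ, V) (𝓘(ℝ, V).prod 𝓘(ℝ, V))
      (fun y ↦ TotalSpace.mk' V y (riemannianGradient (V := V) f y)) x := by
  refine mdifferentiableAt_vectorField_of_inner fun τ hτ ↦ ?_
  simp only [inner_riemannianGradient]
  exact mdifferentiableAt_mvfderiv_vectorField hf hτ

variable {V' : Type*} [NormedAddCommGroup V'] [NormedSpace ℝ V'] [FiniteDimensional ℝ V']
  {B : Type*} [TopologicalSpace B] [ChartedSpace V' B]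
  [RiemannianBundle (fun b : B ↦ TangentSpace 𝓘(ℝ, V') b)]

/-- The lift of a gradient is the horizontal gradient of the pulled-back function, as the lift is
adjoint to `dp`. -/
lemma IsRiemannianSubmersion.horizontalLift_riemannianGradient {p : M → B}
    (hp : IsRiemannianSubmersion (V := V) (V' := V') p) {f : B → ℝ} {x : M}
    (hf : MDiffAt f (p x)) :
    horizontalLift (V := V) (V' := V') p x (riemannianGradient (V := V') f (p x)) =
      subbundleGradient (horizontalSpace (V := V) (V' := V') p) (f ∘ p) x := by
  have hmem := Submodule.sub_mem _ (hp.horizontalLift_mem x (riemannianGradient (V := V') f (p x)))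
    (subbundleGradient_mem (horizontalSpace (V := V) (V' := V') p) (f ∘ p) x)
  refine sub_eq_zero.1 (inner_self_eq_zero (𝕜 := ℝ).1 ?_)
  rw [inner_sub_left, inner_subbundleGradient _ _ _ hmem, real_inner_comm,
    hp.inner_horizontalLift, real_inner_comm, inner_riemannianGradient,
    mvfderiv_comp_manifold_apply hf ((hp.contMDiff x).mdifferentiableAt (by simp)), sub_self]

end

/-! ### Ambient gradients -/

section

variable {E : Type*} [NormedAddCommGroup E] [InnerProductSpace ℝ E] [FiniteDimensional ℝ E]

lemma OrthonormalBasis.sum_fderiv_smul_eq_gradient {n : Type*} [Fintype n]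
    (e : OrthonormalBasis n ℝ E) (f : E → ℝ) (x : E) :
    ∑ i, fderiv ℝ f x (e i) • e i = gradient f x := by
  rw [← e.sum_repr' (gradient f x)]
  exact Finset.sum_congr rfl fun i _ ↦ by rw [inner_gradient_right, conj_trivial]

variable {V : Type*} [NormedAddCommGroup V] [NormedSpace ℝ V]
  {M : Type*} [TopologicalSpace M] [ChartedSpace V M]

lemma isAmbientGradient_gradient {ι : M → E} (hι : ∀ Y, MDiffAt ι Y) {f : M → ℝ} {fhat : E → ℝ}
    (hf : ∀ Y, fhat (ι Y) = f Y) (hd : ∀ Y, DifferentiableAt ℝ fhat (ι Y)) :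
    IsAmbientGradient (V := V) ι f (fun Y ↦ gradient fhat (ι Y)) := by
  intro η Y
  obtain rfl : fhat ∘ ι = f := funext hf
  rw [mvfderiv_comp_manifold_apply (hd Y).mdifferentiableAt (hι Y), inner_gradient_right,
    conj_trivial]
  exact congrArg (fun T : E →L[ℝ] ℝ ↦ T (mvfderiv 𝓘(ℝ, V) ι Y (η Y))) mfderiv_eq_fderiv.symm

end

/-! ### Tangent spaces of level sets -/

section

variable {V : Type*} [NormedAddCommGroup V] [NormedSpace ℝ V]
  {M : Type*} [TopologicalSpace M] [ChartedSpace V M]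
  {E : Type*} [NormedAddCommGroup E] [InnerProductSpace ℝ E]

/-- The velocity of a curve that runs in an embedded submanifold is tangent to it. The curve is
pulled back to the manifold by a local left inverse of the embedding, the projection to the first
factor in charts in which the embedding is `u ↦ (u, 0)`. -/
lemma mem_range_mvfderiv_of_hasDerivAt {ι : M → E}
    (hι : IsSmoothEmbedding 𝓘(ℝ, V) 𝓘(ℝ, E) ∞ ι) {Y : M} {γ : ℝ → E} {v : E}
    (hγ : HasDerivAt γ v 0) (hY : γ 0 = ι Y) (hr : ∀ᶠ t in 𝓝 0, γ t ∈ Set.range ι) :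
    ∃ u, mvfderiv 𝓘(ℝ, V) ι Y u = v := by
  have h := hι.isImmersion.isImmersionAt Y
  let k : E → M := fun a ↦ h.domChart.symm (h.equiv.symm (h.codChart a)).1
  have hfst : ∀ y ∈ h.domChart.source, (h.equiv.symm (h.codChart (ι y))).1 = h.domChart y := by
    intro y hy
    have hw := h.writtenInCharts (show h.domChart y ∈ (h.domChart.extend 𝓘(ℝ, V)).target by
      simpa using h.domChart.map_source hy)
    simp [h.domChart.left_inv hy] at hw
    simp [hw]
  have hk : ∀ y ∈ h.domChart.source, k (ι y) = y := fun y hy ↦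
    (congrArg h.domChart.symm (hfst y hy)).trans (h.domChart.left_inv hy)
  have hkd : MDifferentiableAt 𝓘(ℝ, E) 𝓘(ℝ, V) k (ι Y) := by
    have h1 : MDifferentiableAt 𝓘(ℝ, E) 𝓘(ℝ, E) h.codChart (ι Y) :=
      (contMDiffAt_of_mem_maximalAtlas h.codChart_mem_maximalAtlas
        h.mem_codChart_source).mdifferentiableAt (by simp)
    have h2 : MDifferentiableAt 𝓘(ℝ, V) 𝓘(ℝ, V) h.domChart.symm
        (h.equiv.symm (h.codChart (ι Y))).1 := by
      rw [hfst Y h.mem_domChart_source]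
      exact (contMDiffAt_symm_of_mem_maximalAtlas h.domChart_mem_maximalAtlas
        (h.domChart.map_source h.mem_domChart_source)).mdifferentiableAt (by simp)
    exact MDifferentiableAt.comp (ι Y) h2
      (((ContinuousLinearMap.fst ℝ V _ ∘L h.equiv.symm.toContinuousLinearMap).differentiableAt
        (x := h.codChart (ι Y))).mdifferentiableAt.comp (ι Y) h1)
  have hc : MDifferentiableAt 𝓘(ℝ, ℝ) 𝓘(ℝ, V) (k ∘ γ) 0 :=
    MDifferentiableAt.comp (0 : ℝ) (by rwa [hY]) hγ.differentiableAt.mdifferentiableAt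
  have hev : ι ∘ (k ∘ γ) =ᶠ[𝓝 0] γ := by
    -- near `0` the curve runs in the image of the source of the chart, as `ι` is inducing
    have hs : h.domChart.source ∈ 𝓝 Y := h.domChart.open_source.mem_nhds h.mem_domChart_source
    rw [hι.isEmbedding.nhds_eq_comap, Filter.mem_comap] at hs
    obtain ⟨S, hS, hSs⟩ := hs
    rw [← hY] at hS
    filter_upwards [hr, hγ.continuousAt hS] with t ht htS
    obtain ⟨y, hy⟩ := ht
    simp only [Function.comp_apply, ← hy]
    rw [hk y (hSs (by rw [Set.mem_preimage, hy]; exact htS))]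
  have hd := mvfderiv_comp_manifold_apply (f := ι) (p := k ∘ γ) (x := (0 : ℝ))
    ((hι.contMDiff _).mdifferentiableAt (by simp)) hc (1 : ℝ)
  rw [hev.mvfderiv_eq] at hd
  have hγ' : mvfderiv 𝓘(ℝ, ℝ) γ 0 (1 : ℝ) = v :=
    (congrArg (fun T : ℝ →L[ℝ] E ↦ T 1) mfderiv_eq_fderiv).trans
      (by rw [hγ.hasFDerivAt.fderiv]; simp)
  have hex : ∃ u, mvfderiv 𝓘(ℝ, V) ι ((k ∘ γ) 0) u = v := ⟨_, hd.symm.trans hγ'⟩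
  rwa [Function.comp_apply, hY, hk Y h.mem_domChart_source] at hex

variable [FiniteDimensional ℝ E]
  {F : Type*} [NormedAddCommGroup F] [InnerProductSpace ℝ F] [FiniteDimensional ℝ F]

/-- The zero set of a map with surjective derivatives has the kernels of these as tangent spaces:
a vector in the kernel is the velocity of a curve that the implicit function theorem provides. -/
lemma isDefiningOperator_top_fderiv {ι : M → E}
    (hι : IsSmoothEmbedding 𝓘(ℝ, V) 𝓘(ℝ, E) ∞ ι) {U : Set E} {C : E → F} (hU : IsOpen U)
    (hC : ContDiffOn ℝ 1 C U) (hr : Set.range ι = {x ∈ U | C x = 0})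
    (hJ : ∀ Y, LinearMap.range (fderiv ℝ C (ι Y)).toLinearMap = ⊤) :
    IsDefiningOperator (V := V) ι (fun _ ↦ ⊤) (fun Y ↦ fderiv ℝ C (ι Y)) := by
  refine fun Y ↦ ⟨hJ Y, le_antisymm ?_ ?_⟩
  · intro v hv
    have hYU : ι Y ∈ U ∧ C (ι Y) = 0 := hr.subset ⟨Y, rfl⟩
    have hs : HasStrictFDerivAt C (fderiv ℝ C (ι Y)) (ι Y) :=
      (hC.contDiffAt (hU.mem_nhds hYU.1)).hasStrictFDerivAt (by simp)
    let v' : (fderiv ℝ C (ι Y)).ker := ⟨v, hv⟩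
    let γ : ℝ → E := fun t ↦ hs.implicitFunction C _ (hJ Y) (C (ι Y)) (t • v')
    have hγ0 : γ 0 = ι Y := by simp [γ]
    have hline : HasDerivAt (fun t : ℝ ↦ t • v') v' 0 := by
      simpa using (hasDerivAt_id (0 : ℝ)).smul_const v'
    have hγ : HasDerivAt γ v 0 :=
      HasFDerivAt.comp_hasDerivAt_of_eq (0 : ℝ) (hs.to_implicitFunction (hJ Y)).hasFDerivAt
        hline (by simp)
    obtain ⟨u, hu⟩ := mem_range_mvfderiv_of_hasDerivAt (V := V) hι hγ hγ0 <| by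
      have h0 : Filter.Tendsto (fun t : ℝ ↦ (C (ι Y), t • v')) (𝓝 0) (𝓝 (C (ι Y), 0)) := by
        have := (continuous_const (y := C (ι Y))).prodMk
          (continuous_id.smul (continuous_const (X := ℝ) (y := v')))
        simpa using this.tendsto (0 : ℝ)
      filter_upwards [h0.eventually (hs.map_implicitFunction_eq (hJ Y)),
        hγ.continuousAt (by rw [hγ0]; exact hU.mem_nhds hYU.1)] with t ht htU
      rw [hr]
      exact ⟨htU, ht.trans hYU.2⟩
    exact ⟨u, trivial, hu⟩
  · rintro _ ⟨u, -, rfl⟩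
    have hYU : ι Y ∈ U ∧ C (ι Y) = 0 := hr.subset ⟨Y, rfl⟩
    have hCd : DifferentiableAt ℝ C (ι Y) :=
      (hC.contDiffAt (hU.mem_nhds hYU.1)).differentiableAt (by simp)
    have h0 : C ∘ ι = fun _ ↦ 0 := funext fun y ↦ (hr.subset ⟨y, rfl⟩ : _ ∧ C (ι y) = 0).2
    have hd := mvfderiv_comp_manifold_apply hCd.mdifferentiableAt
      ((hι.contMDiff Y).mdifferentiableAt (by simp)) u
    rw [h0, mvfderiv_const] at hd
    exact (congrArg (fun T : E →L[ℝ] F ↦ T (mvfderiv 𝓘(ℝ, V) ι Y u))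
      mfderiv_eq_fderiv.symm).trans hd.symm

/-- The formula `a - A⁻¹ Jᵗ (J A⁻¹ Jᵗ)⁻¹ J a` for the projection to the kernel of a surjective
operator `J`. -/
lemma metricProjection_ker {A : E →L[ℝ] E} (hs : ∀ a b : E, ⟪A a, b⟫ = ⟪a, A b⟫)
    (hp : ∀ a : E, a ≠ 0 → 0 < ⟪a, A a⟫) {J : E →L[ℝ] F}
    (hJ : LinearMap.range J.toLinearMap = ⊤) :
    (J ∘L A.inverse ∘L J.adjoint).IsInvertible ∧
      ∀ a : E, metricProjection A (LinearMap.ker J.toLinearMap) a =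
        a - A.inverse (J.adjoint ((J ∘L A.inverse ∘L J.adjoint).inverse (J a))) := by
  have hA := ContinuousLinearMap.isInvertible_of_inner_pos hp
  have hinv : (J ∘L A.inverse ∘L J.adjoint).IsInvertible := by
    refine ContinuousLinearMap.isInvertible_of_inner_pos fun b hb ↦ ?_
    have hne : J.adjoint b ≠ 0 := by
      intro h0
      obtain ⟨a, ha⟩ := LinearMap.range_eq_top.1 hJ b
      have hin := J.adjoint_inner_left a b
      rw [h0, inner_zero_left, show J a = b from ha] at hin
      exact hb (inner_self_eq_zero.1 hin.symm)
    have hself := hA.self_apply_inverse (J.adjoint b)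
    have hpos := hp (A.inverse (J.adjoint b)) fun h0 ↦ hne (by rw [← hself, h0, map_zero])
    rw [hself, J.adjoint_inner_right, real_inner_comm] at hpos
    exact hpos
  refine ⟨hinv, fun a ↦ (eq_metricProjection A _ hs hp _ _ ?_ fun w hw ↦ ?_).symm⟩
  · have h := hinv.self_apply_inverse (J a)
    change J (a - _) = 0
    rw [map_sub, sub_eq_zero]
    exact h.symm
  · have hw0 : J w = 0 := hw
    rw [inner_sub_left, ← hs (A.inverse _), hA.self_apply_inverse, J.adjoint_inner_left, hw0,
      inner_zero_right, sub_zero]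

end

/-! ### Lifting the connection, gradients and Hessians -/

theorem mainTheorem8
    {E : Type*} [NormedAddCommGroup E] [InnerProductSpace ℝ E] [FiniteDimensional ℝ E]
    {V : Type*} [NormedAddCommGroup V] [NormedSpace ℝ V] [FiniteDimensional ℝ V]
    {M : Type*} [TopologicalSpace M] [ChartedSpace V M] [IsManifold 𝓘(ℝ, V) ∞ M]
    [RiemannianBundle (fun x : M ↦ TangentSpace 𝓘(ℝ, V) x)]
    [IsContMDiffRiemannianBundle 𝓘(ℝ, V) ∞ V (fun x : M ↦ TangentSpace 𝓘(ℝ, V) x)]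
    (ι : M → E) (g : M → E →L[ℝ] E) (hM : IsEmbeddedAmbientStructure (V := V) ι g)
    -- the target space of the constraint
    {F : Type*} [NormedAddCommGroup F] [InnerProductSpace ℝ F] [FiniteDimensional ℝ F]
    -- the base of the submersion
    {V' : Type*} [NormedAddCommGroup V'] [NormedSpace ℝ V'] [FiniteDimensional ℝ V']
    {B : Type*} [TopologicalSpace B] [ChartedSpace V' B] [IsManifold 𝓘(ℝ, V') ∞ B]
    [RiemannianBundle (fun b : B ↦ TangentSpace 𝓘(ℝ, V') b)]
    [IsContMDiffRiemannianBundle 𝓘(ℝ, V') ∞ V' (fun b : B ↦ TangentSpace 𝓘(ℝ, V') b)] :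
    -- the vector of partial derivatives of an extension is an ambient gradient
    (∀ {n : Type*} [Fintype n] (e : OrthonormalBasis n ℝ E) (f : M → ℝ) (fhat : E → ℝ),
      (∀ Y, fhat (ι Y) = f Y) → (∀ Y, DifferentiableAt ℝ fhat (ι Y)) →
      (∀ Y, ∑ i, fderiv ℝ fhat (ι Y) (e i) • e i = gradient fhat (ι Y)) ∧
      IsAmbientGradient (V := V) ι f (fun Y ↦ ∑ i, fderiv ℝ fhat (ι Y) (e i) • e i)) ∧
    -- a full-rank Jacobian of defining equations serves as the operator `J` for `T M`
    (∀ (U : Set E) (C : E → F), IsOpen U → ContDiffOn ℝ 1 C U →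
      Set.range ι = {x ∈ U | C x = 0} →
      (∀ Y, Module.finrank ℝ (LinearMap.range (fderiv ℝ C (ι Y)).toLinearMap) =
        Module.finrank ℝ F) →
      IsDefiningOperator (V := V) ι (fun _ ↦ ⊤) (fun Y ↦ fderiv ℝ C (ι Y)) ∧
      ∀ Y, letI J := fderiv ℝ C (ι Y)
        (J ∘L (g Y).inverse ∘L J.adjoint).IsInvertible ∧
        ∀ a : E, bundleProjection (V := V) ι g (fun _ ↦ ⊤) Y a =
          a - (g Y).inverse (J.adjoint ((J ∘L (g Y).inverse ∘L J.adjoint).inverse (J a)))) ∧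
    -- Riemannian submersions
    (∀ p : M → B, IsRiemannianSubmersion (V := V) (V' := V') p →
      ∀ nablaM : CovariantDerivative 𝓘(ℝ, V) V (TangentSpace 𝓘(ℝ, V) : M → Type _),
      ∀ nablaB : CovariantDerivative 𝓘(ℝ, V') V' (TangentSpace 𝓘(ℝ, V') : B → Type _),
      IsLeviCivita nablaM → IsLeviCivita nablaB →
      letI H := horizontalSpace (V := V) (V' := V') p
      -- the Levi-Civita connection of `B` lifts to `Π_{H,g} ∇`
      (∀ ξ η : ∀ b : B, TangentSpace 𝓘(ℝ, V') b, IsSmoothVectorField ξ → IsSmoothVectorField η →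
        ∀ Y : M, mvfderiv 𝓘(ℝ, V) ι Y (horizontalLiftField p (fun b ↦ nablaB η b (ξ b)) Y) =
          bundleProjection ι g H Y (mvfderiv 𝓘(ℝ, V) ι Y
            (nablaM (horizontalLiftField p η) Y (horizontalLiftField p ξ Y)))) ∧
      -- hence it is given by the Christoffel function
      (∃ X, IsIndexRaisingTerm (V := V) ι g X) ∧
      (∀ X, IsIndexRaisingTerm (V := V) ι g X → ∀ ξ η : ∀ b : B, TangentSpace 𝓘(ℝ, V') b,
        IsSmoothVectorField ξ → IsSmoothVectorField η →
        ∀ Y : M, bundleProjection ι g H Y (mvfderiv 𝓘(ℝ, V) ι Y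
            (nablaM (horizontalLiftField p η) Y (horizontalLiftField p ξ Y))) =
          mvfderiv 𝓘(ℝ, V) (fun Z ↦ mvfderiv 𝓘(ℝ, V) ι Z (horizontalLiftField p η Z)) Y
              (horizontalLiftField p ξ Y) +
            christoffelFunction ι g X H Y (horizontalLiftField p ξ Y)
              (horizontalLiftField p η Y)) ∧
      -- gradients and Hessians on `B` lift to `H`-gradients and `H`-Hessians on `M`
      (∀ f : B → ℝ, ContMDiff 𝓘(ℝ, V') 𝓘(ℝ, ℝ) ∞ f → ∀ Y : M,
        horizontalLift (V := V) (V' := V') p Y (riemannianGradient (V := V') f (p Y)) = subbundleGradient H (f ∘ p) Y ∧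
        (∀ v : TangentSpace 𝓘(ℝ, V') (p Y),
          mvfderiv 𝓘(ℝ, V) ι Y (horizontalLift (V := V) (V' := V') p Y (riemannianHessian nablaB f (p Y) v)) =
            subbundleHessian ι g nablaM H (f ∘ p) Y (horizontalLift (V := V) (V' := V') p Y v)) ∧
        (∀ v w : TangentSpace 𝓘(ℝ, V') (p Y),
          riemannianHessianForm nablaB f (p Y) v w =
            subbundleHessianForm ι g nablaM H (f ∘ p) Y
              (horizontalLift (V := V) (V' := V') p Y v) (horizontalLift (V := V) (V' := V') p Y w)))) := by
  refine ⟨fun e f fhat hf hd ↦ ?_, fun U C hU hC hr hrank ↦ ?_,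
    fun p hp nablaM nablaB hnM hnB ↦ ⟨fun ξ η _ hη Y ↦ ?_, hM.exists_isIndexRaisingTerm,
      fun X hX ξ η _ hη Y ↦ ?_, fun f hf Y ↦ ?_⟩⟩
  · simp only [e.sum_fderiv_smul_eq_gradient]
    exact ⟨fun _ ↦ trivial, isAmbientGradient_gradient
      (fun Y ↦ (hM.isSmoothEmbedding.contMDiff Y).mdifferentiableAt (by simp)) hf hd⟩
  · have hJ : ∀ Y, LinearMap.range (fderiv ℝ C (ι Y)).toLinearMap = ⊤ := fun Y ↦
      Submodule.eq_top_of_finrank_eq (hrank Y)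
    have hD := isDefiningOperator_top_fderiv hM.isSmoothEmbedding hU hC hr hJ
    refine ⟨hD, fun Y ↦ ?_⟩
    rw [bundleProjection, ← (hD Y).2]
    exact metricProjection_ker (hM.metric_symm Y) (hM.metric_pos Y) (hJ Y)
  · exact hM.mvfderiv_horizontalLift_nabla hp hnM hnB ((hη (p Y)).mdifferentiableAt (by simp)) _
  · exact hM.bundleProjection_nabla_eq hp hnM hX
      (hp.mdifferentiableAt_horizontalLiftField ((hη (p Y)).mdifferentiableAt (by simp)))
      (fun y ↦ hp.horizontalLift_mem y _) _
  · have hgrad : subbundleGradient (horizontalSpace (V := V) (V' := V') p) (f ∘ p) =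
        horizontalLiftField p (riemannianGradient (V := V') f) := funext fun y ↦
      (hp.horizontalLift_riemannianGradient ((hf (p y)).mdifferentiableAt (by simp))).symm
    have hsm := mdifferentiableAt_riemannianGradient ((hf (p Y)).of_le ENat.LEInfty.out)
    have hhess : ∀ v : TangentSpace 𝓘(ℝ, V') (p Y),
        mvfderiv 𝓘(ℝ, V) ι Y (horizontalLift p Y (riemannianHessian nablaB f (p Y) v)) =
          subbundleHessian ι g nablaM (horizontalSpace (V := V) (V' := V') p) (f ∘ p) Y
            (horizontalLift p Y v) := by
      intro v
      rw [subbundleHessian, hgrad]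
      exact hM.mvfderiv_horizontalLift_nabla hp hnM hnB hsm v
    refine ⟨(congrFun hgrad Y).symm, hhess, fun v w ↦ ?_⟩
    rw [subbundleHessianForm, ← hhess, ← hM.inner_eq, hp.inner_horizontalLift,
      hp.mfderiv_horizontalLift, riemannianHessianForm]
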